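/- Let $n\ge 2$ and let $\dot x=f(x)=f^{(0)}(x)+\cdots+f^{(m)}(x)$ be a polynomial differential equation in $\mathbb C^n$, each $f^{(j)}$ homogeneous of degree $j$ and $f^{(m)}\neq 0$; let $X_f=\sum_i f_i\,\partial/\partial x_i$, extended (uniquely) to functions algebraic over $\mathbb C(x_1,\dots,x_n)$. A semi-invariant of $f$ is a nonconstant polynomial $\psi$ with $X_f(\psi)=\lambda\psi$ for some polynomial $\lambda$. A Jacobi multiplier of $f$ is a function $\sigma\ne0$, here algebraic over $\mathbb C(x_1,\dots,x_n)$, with $X_f(\sigma)+\operatorname{div}f\cdot\sigma=0$. Poincaré transforms. Let $g_i(x_1,\dots,x_{n+1})=\sum_{j=0}^m f_i^{(j)}(x_1,\dots,x_n)\,x_{n+1}^{m-j}$ for $1\le i\le n$ and $g_{n+1}=0$. Then $f^*_{e_1}$ is the vector field in the $n$ variables $x_2,\dots,x_{n+1}$ with components $-g_1x_i+g_i$ $(2\le i\le n+1)$, evaluated at $x_1=1$. For $v\in\mathbb C^n\setminus\{0\}$ put $f_v^*=(T\circ f\circ T^{-1})^*_{e_1}$ with an invertible matrix $T$ such that $Tv=e_1$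 (another choice of $T$ conjugates $f_v^*$ by a linear map). A stationary point at infinity is a line $\mathbb Cv$ such that $f_v^*(0)=0$; its eigenvalues are the eigenvalues $\lambda_1,\dots,\lambda_n$ of $Df_v^*(0)$, counted with multiplicity. Property E: at every stationary point at infinity, either (1) $\lambda_1,\dots,\lambda_n$ are linearly independent over $\mathbb Q$, or (2) $\dim_{\mathbb Q}(\mathbb Q\lambda_1+\cdots+\mathbb Q\lambda_n)=n-1$ and $\sum_i m_i\lambda_i=0$ for some positive integers $m_1,\dots,m_n$. Property S: every homogeneous algebraic set $Y\subsetneq\mathbb C^n$ with $\dim Y\ge 1$ which is invariant for $\dot x=f^{(m)}(x)$ contains a line $\mathbb Cv$, $v\ne0$, with $f^{(m)}(v)\in\mathbb Cv$. Theorem. Let $f$ satisfy properties E and S. Let $\phi_1,\dots,\phi_s$ be irreducible, pairwise relatively prime semi-invariants of $f$, of degrees $r_1,\dots,r_s$, and let $d_1,\dots,d_s$ be nonzero rational numbers such that (a branch of) $\left(\phi_1^{d_1}\cdots\phi_s^{d_s}\right)^{-1}$ is a Jacobi multiplier of $f$. Assume that there is a stationary point at infinity whose eigenvalues are linearly independent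 over $\mathbb Q$. Then $$d_1=\cdots=d_s=1\qquad\text{and}\qquad \sum_{i=1}^s r_i=m+n-1.$$ -/

import Mathlib

open MvPolynomial

noncomputable section

namespace PolyVF

/-- A polynomial vector field `ẋ = f(x)` on `ℂⁿ`, given by its `n` components. -/
abbrev VField (n : ℕ) := Fin n → MvPolynomial (Fin n) ℂ

/-- The homogeneous part `f^{(j)}` of degree `j` of a vector field. -/
def homPart {n : ℕ} (j : ℕ) (f : VField n) : VField n :=
  fun i => homogeneousComponent j (f i)

/-- `f = f^{(0)} + ⋯ + f^{(m)}` with `f^{(m)} ≠ 0`. -/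
def HasDegree {n : ℕ} (f : VField n) (m : ℕ) : Prop :=
  (∀ i, (f i).totalDegree ≤ m) ∧ homPart m f ≠ 0

/-- The value of the vector field at a point of `ℂⁿ`. -/
def value {n : ℕ} (f : VField n) (x : Fin n → ℂ) : Fin n → ℂ := fun i => eval x (f i)

/-- The Lie derivative `X_f = ∑ f_i ∂/∂x_i` on polynomials. -/
def lieDeriv {n : ℕ} (f : VField n) :
    Derivation ℂ (MvPolynomial (Fin n) ℂ) (MvPolynomial (Fin n) ℂ) :=
  mkDerivation ℂ f

/-- The divergence `∑ ∂f_i/∂x_i`. -/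
def divergence {n : ℕ} (f : VField n) : MvPolynomial (Fin n) ℂ := ∑ i, pderiv i (f i)

/-- `ψ` is nonconstant and `X_f(ψ) = l * ψ` for some polynomial `l`. -/
def IsSemiInvariant {n : ℕ} (f : VField n) (ψ : MvPolynomial (Fin n) ℂ) : Prop :=
  (∀ c : ℂ, ψ ≠ C c) ∧ ∃ l : MvPolynomial (Fin n) ℂ, lieDeriv f ψ = l * ψ

/-! ### Poincaré transforms -/

/-- The homogenization of `f` (of degree `m`) with respect to the additional last variable:
a vector field in one more variable, the last component of which is `0`. -/
def homogenization {n : ℕ} (m : ℕ) (f : VField n) : VField (n + 1) :=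
  Fin.snoc (α := fun _ => MvPolynomial (Fin (n + 1)) ℂ)
    (fun i => ∑ j ∈ Finset.range (m + 1),
      rename Fin.castSucc (homogeneousComponent j (f i)) * X (Fin.last n) ^ (m - j)) 0

/-- The projection `P g = -g₁ x + x₁ g` with respect to the first coordinate. -/
def projection {n : ℕ} (g : VField (n + 1)) : VField (n + 1) :=
  fun i => -(g 0) * X i + X 0 * g i

/-- The special Poincaré transform `f^*_{e₁}`: drop the first component of the projection of the
homogenization and put the first variable equal to `1`. The variables `x₂, …, x_{n+1}` are
indexed by `Fin n`. -/
def poincareE1 {n : ℕ} (m : ℕ) (f : VField n) : VField n :=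
  fun i => aeval (Fin.cons (α := fun _ => MvPolynomial (Fin n) ℂ) 1 X)
    (projection (homogenization m f) i.succ)

/-- The conjugated vector field `T ∘ f ∘ T⁻¹`. -/
def conjugate {n : ℕ} (T : Matrix (Fin n) (Fin n) ℂ) (f : VField n) : VField n :=
  fun i => ∑ j, C (T i j) * aeval (fun k => ∑ l, C (T⁻¹ k l) * X l) (f j)

/-- The first standard basis vector of `ℂⁿ`. -/
def e1 (n : ℕ) : Fin n → ℂ := fun i => if (i : ℕ) = 0 then 1 else 0

/-- `F` is a Poincaré transform `f^*_v` of `f` with respect to the nonzero vector `v`. -/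
def IsPoincareTransform {n : ℕ} (m : ℕ) (f : VField n) (v : Fin n → ℂ) (F : VField n) : Prop :=
  v ≠ 0 ∧ ∃ T : Matrix (Fin n) (Fin n) ℂ, IsUnit T.det ∧ T.mulVec v = e1 n ∧
    F = poincareE1 m (conjugate T f)

/-- The Jacobian of a vector field at the origin. -/
def jacobianAtZero {n : ℕ} (F : VField n) : Matrix (Fin n) (Fin n) ℂ :=
  Matrix.of fun i j => eval 0 (pderiv j (F i))

/-! ### Conditions on eigenvalues -/

/-- `ev` lists the eigenvalues of `B` with their algebraic multiplicities. -/
def IsEigenvalueList {n : ℕ} (B : Matrix (Fin n) (Fin n) ℂ) (ev : Fin n → ℂ) : Prop :=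
  B.charpoly = ∏ i, (Polynomial.X - Polynomial.C (ev i))

/-- The eigenvalues of `B` are linearly independent over `ℚ`. -/
def EigCond1 {n : ℕ} (B : Matrix (Fin n) (Fin n) ℂ) : Prop :=
  ∃ ev : Fin n → ℂ, IsEigenvalueList B ev ∧ LinearIndependent ℚ ev

/-- The eigenvalues of `B` span a `ℚ`-vector space of dimension `n - 1` and satisfy a linear
relation with positive integer coefficients. -/
def EigCond2 {n : ℕ} (B : Matrix (Fin n) (Fin n) ℂ) : Prop :=
  ∃ ev : Fin n → ℂ, IsEigenvalueList B ev ∧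
    Module.finrank ℚ (Submodule.span ℚ (Set.range ev)) + 1 = n ∧
    ∃ k : Fin n → ℕ, (∀ i, 0 < k i) ∧ ∑ i, (k i : ℂ) * ev i = 0

/-- Property E of a vector field of degree `m`. -/
def PropertyE {n : ℕ} (m : ℕ) (f : VField n) : Prop :=
  ∀ (v : Fin n → ℂ) (F : VField n), IsPoincareTransform m f v F → value F 0 = 0 →
    EigCond1 (jacobianAtZero F) ∨ EigCond2 (jacobianAtZero F)

/-! ### Property S -/

/-- `Y ⊆ ℂⁿ` is the common zero set of a family of homogeneous polynomials. -/
def IsHomogeneousVariety {n : ℕ} (Y : Set (Fin n → ℂ)) : Prop :=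
  ∃ S : Set (MvPolynomial (Fin n) ℂ), (∀ p ∈ S, ∃ k : ℕ, p.IsHomogeneous k) ∧
    Y = {x | ∀ p ∈ S, eval x p = 0}

/-- The dimension of the Zariski closed set `Y` (Krull dimension of its coordinate ring). -/
def varietyDim {n : ℕ} (Y : Set (Fin n → ℂ)) : WithBot ℕ∞ :=
  ringKrullDim (MvPolynomial (Fin n) ℂ ⧸ vanishingIdeal ℂ Y)

/-- `Y` is invariant for the flow of `ẋ = p(x)`: a solution on an open interval that meets `Y`
stays in `Y`. -/
def IsFlowInvariant {n : ℕ} (p : VField n) (Y : Set (Fin n → ℂ)) : Prop :=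
  ∀ (a b : ℝ) (x : ℝ → Fin n → ℂ),
    (∀ t ∈ Set.Ioo a b, HasDerivAt x (value p (x t)) t) →
    ∀ t₀ ∈ Set.Ioo a b, x t₀ ∈ Y → ∀ t ∈ Set.Ioo a b, x t ∈ Y

/-- Property S of a vector field of degree `m`. -/
def PropertyS {n : ℕ} (m : ℕ) (f : VField n) : Prop :=
  ∀ Y : Set (Fin n → ℂ), IsHomogeneousVariety Y → Y ≠ Set.univ →
    IsFlowInvariant (homPart m f) Y → 1 ≤ varietyDim Y →
    ∃ v : Fin n → ℂ, v ≠ 0 ∧ (∃ c : ℂ, value (homPart m f) v = c • v) ∧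
      ∀ c : ℂ, c • v ∈ Y

/-! ### Algebraic functions and Jacobi multipliers -/

/-- The field of algebraic functions: an algebraic closure of `ℂ(x₁, …, xₙ)`. -/
abbrev AlgFun (n : ℕ) := AlgebraicClosure (FractionRing (MvPolynomial (Fin n) ℂ))

instance instFormallyEtaleAlgFun (n : ℕ) :
    Algebra.FormallyEtale (MvPolynomial (Fin n) ℂ) (AlgFun n) :=
  haveI : Algebra.FormallyEtale (MvPolynomial (Fin n) ℂ)
      (FractionRing (MvPolynomial (Fin n) ℂ)) :=
    Algebra.FormallyEtale.of_isLocalization (nonZeroDivisors (MvPolynomial (Fin n) ℂ))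
  haveI : Algebra.FormallyEtale (FractionRing (MvPolynomial (Fin n) ℂ)) (AlgFun n) :=
    Algebra.FormallyEtale.of_isSeparable _ _
  Algebra.FormallyEtale.comp (MvPolynomial (Fin n) ℂ)
    (FractionRing (MvPolynomial (Fin n) ℂ)) (AlgFun n)

/-- The Lie derivative `X_f` on algebraic functions, the (unique) extension of `X_f` from
polynomials; see `lieDerivAlg_algebraMap`. -/
def lieDerivAlg {n : ℕ} (f : VField n) : Derivation ℂ (AlgFun n) (AlgFun n) :=
  ((LinearMap.liftBaseChange (AlgFun n)
      ((Algebra.linearMap (MvPolynomial (Fin n) ℂ) (AlgFun n)).comp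
        (lieDeriv f).liftKaehlerDifferential)).comp
    (KaehlerDifferential.tensorKaehlerEquivOfFormallyEtale ℂ (MvPolynomial (Fin n) ℂ)
      (AlgFun n)).symm.toLinearMap).compDer (KaehlerDifferential.D ℂ (AlgFun n))

theorem lieDerivAlg_algebraMap {n : ℕ} (f : VField n) (ψ : MvPolynomial (Fin n) ℂ) :
    lieDerivAlg f (algebraMap _ (AlgFun n) ψ) = algebraMap _ (AlgFun n) (lieDeriv f ψ) := by
  simp [lieDerivAlg, KaehlerDifferential.tensorKaehlerEquivOfFormallyEtale_symm_D_algebraMap]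

/-- `σ ≠ 0` is a Jacobi multiplier of `f`: `X_f(σ) + div f · σ = 0`. -/
def IsJacobiMultiplier {n : ℕ} (f : VField n) (σ : AlgFun n) : Prop :=
  σ ≠ 0 ∧ lieDerivAlg f σ + algebraMap _ (AlgFun n) (divergence f) * σ = 0

/-- `ρ` is a branch of the power `φ ^ d`, `d ∈ ℚ`: if `d = p / q` in lowest terms with `q > 0`,
then `ρ ^ q = φ ^ p`. -/
def IsRatPow {n : ℕ} (φ : MvPolynomial (Fin n) ℂ) (d : ℚ) (ρ : AlgFun n) : Prop :=
  ρ ^ d.den = (algebraMap _ (AlgFun n) φ) ^ d.num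

end PolyVF

end

/-! The multiplier condition says that the cofactors `l i` of the `φ i` satisfy `∑ d i * l i = div
f`. In the chart at a stationary point at infinity the transforms of the `φ i` are semi-invariants
of the Poincaré transform `F`, and so is the equation `x_{n+1}` of the hyperplane at infinity. The
formula for `div F` shows that the cofactor identity persists for `F` if `x_{n+1}` receives the
exponent `d_∞ = m + n - ∑ d i * r i` (`exists_local_semiinvariants`).

Locally, diagonalize `DF(0)` with eigenvalues `λ_j`. If `x^a` is a monomial of lowest degree in a
semi-invariant, its cofactor has the value `∑ a_j λ_j` at `0`. Both alternatives of property E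
exclude the harmful resonances: formally there is an invariant hypersurface `y_j = 0` tangent to
each `x_j = 0`, and every semi-invariant is a unit times `∏ y_j ^ a_j`. A prime polynomial contains
no `y_j` twice, and two coprime primes share none (`exponent_le_one`, `dvd_of_common_exponent`). The
proof replaces power series by polynomials modulo `𝔪 ^ N` and gets the contradictions by eliminating
`x_j`. The exponents `a_i` are thus 0/1 vectors with disjoint supports, and the cofactor identity at
`0` reads `∑ c_j λ_j = 0` with `c_j = ∑ d_i a_ij - 1`, where each `d_i - 1` with `ψ_i(0) = 0` occurs
among the `c_j` (`exists_exponents`).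

For independent eigenvalues all `c_j` vanish. At the given point this yields `d_∞ = 1`. In the
second alternative `c` is a multiple of a positive relation; as `d_∞ = 1` makes one `c_j` vanish,
all do. Hence `d i = 1` for every `φ i` through some stationary point at infinity, and property S,
applied to the zero set of the top degree part of `φ i`, provides such a point. Finally `d_∞ = 1`
becomes the degree formula. -/

noncomputable section

namespace PolyVF

/-! ### The adic filtration and semi-invariants near a nonresonant stationary point -/

variable {n : ℕ}

/-- The ideal of polynomials without constant term. -/
local notation "𝔪" => idealOfVars (Fin n) ℂ

/-- The weight `∑ aᵢ λᵢ` of an exponent `a`. -/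
def weight {n : ℕ} (ev : Fin n → ℂ) (a : Fin n →₀ ℕ) : ℂ := ∑ i, (a i : ℂ) * ev i

theorem weight_add (ev : Fin n → ℂ) (a b : Fin n →₀ ℕ) :
    weight ev (a + b) = weight ev a + weight ev b := by
  simp [weight, add_mul, Finset.sum_add_distrib]

theorem weight_single (ev : Fin n → ℂ) (j : Fin n) :
    weight ev (Finsupp.single j 1) = ev j := by
  classical
  simp [weight, Finsupp.single_apply]

/-- Exponents of the same weight are comparable as soon as their degrees are. -/
def Nonresonant {n : ℕ} (ev : Fin n → ℂ) : Prop :=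
  ∀ a b : Fin n →₀ ℕ, weight ev a = weight ev b → a.degree ≤ b.degree → a ≤ b

theorem mem_pow_of_le {p : MvPolynomial (Fin n) ℂ} {k l : ℕ} (h : k ≤ l) (hp : p ∈ 𝔪 ^ l) :
    p ∈ 𝔪 ^ k := Ideal.pow_le_pow_right h hp

theorem coeff_eq_zero_of_mem {p : MvPolynomial (Fin n) ℂ} {k : ℕ} (hp : p ∈ 𝔪 ^ k)
    {a : Fin n →₀ ℕ} (ha : a.degree < k) : coeff a p = 0 :=
  (mem_pow_idealOfVars_iff' k p).1 hp a ha

theorem coeff_eq_of_sub_mem {p q : MvPolynomial (Fin n) ℂ} {k : ℕ} (h : p - q ∈ 𝔪 ^ k)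
    {a : Fin n →₀ ℕ} (ha : a.degree < k) : coeff a p = coeff a q := by
  simpa [sub_eq_zero] using coeff_eq_zero_of_mem h ha

theorem mem_pow_succ_iff {p : MvPolynomial (Fin n) ℂ} {k : ℕ} (hp : p ∈ 𝔪 ^ k) :
    p ∈ 𝔪 ^ (k + 1) ↔ ∀ a : Fin n →₀ ℕ, a.degree = k → coeff a p = 0 := by
  constructor
  · intro h a ha
    exact coeff_eq_zero_of_mem h (by omega)
  · intro h
    refine (mem_pow_idealOfVars_iff' _ _).2 fun a ha => ?_
    rcases Nat.lt_succ_iff_lt_or_eq.1 ha with h1 | h1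
    · exact coeff_eq_zero_of_mem hp h1
    · exact h a h1

theorem X_mem (j : Fin n) : (X j : MvPolynomial (Fin n) ℂ) ∈ 𝔪 :=
  Ideal.subset_span ⟨j, rfl⟩

theorem X_mul_mem {p : MvPolynomial (Fin n) ℂ} {k : ℕ} (j : Fin n) (hp : p ∈ 𝔪 ^ k) :
    X j * p ∈ 𝔪 ^ (k + 1) := by
  rw [pow_succ']
  exact Ideal.mul_mem_mul (X_mem j) hp

theorem mem_of_X_mul_mem {p : MvPolynomial (Fin n) ℂ} {k : ℕ} {j : Fin n}
    (hp : X j * p ∈ 𝔪 ^ (k + 1)) : p ∈ 𝔪 ^ k := by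
  refine (mem_pow_idealOfVars_iff' _ _).2 fun a ha => ?_
  rw [← coeff_X_mul a j p]
  apply coeff_eq_zero_of_mem hp
  rw [map_add, Finsupp.degree_single]
  omega

theorem mul_mem_pow_add {p q : MvPolynomial (Fin n) ℂ} {k l : ℕ} (hp : p ∈ 𝔪 ^ k)
    (hq : q ∈ 𝔪 ^ l) : p * q ∈ 𝔪 ^ (k + l) := by
  rw [pow_add]
  exact Ideal.mul_mem_mul hp hq

theorem pderiv_mem {p : MvPolynomial (Fin n) ℂ} {k : ℕ} (i : Fin n) (hp : p ∈ 𝔪 ^ (k + 1)) :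
    pderiv i p ∈ 𝔪 ^ k := by
  refine (mem_pow_idealOfVars_iff' _ _).2 fun a ha => ?_
  rw [coeff_pderiv, coeff_eq_zero_of_mem hp, zero_mul]
  rw [map_add, Finsupp.degree_single]
  omega

theorem sub_C_coeff_zero_mem (p : MvPolynomial (Fin n) ℂ) : p - C (coeff 0 p) ∈ 𝔪 := by
  rw [← pow_one 𝔪]
  refine (mem_pow_idealOfVars_iff' _ _).2 fun a ha => ?_
  have : a = 0 := by
    rw [← Finsupp.degree_eq_zero_iff]
    omega
  simp [this]

theorem coeff_mul_of_mem (κ : MvPolynomial (Fin n) ℂ) {p : MvPolynomial (Fin n) ℂ} {k : ℕ}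
    (hp : p ∈ 𝔪 ^ k) {a : Fin n →₀ ℕ} (ha : a.degree ≤ k) :
    coeff a (κ * p) = coeff 0 κ * coeff a p := by
  have h : κ * p - C (coeff 0 κ) * p ∈ 𝔪 ^ (k + 1) := by
    rw [← sub_mul, pow_succ']
    exact Ideal.mul_mem_mul (sub_C_coeff_zero_mem κ) hp
  rw [coeff_eq_of_sub_mem h (by omega), coeff_C_mul]

/-- The chain rule for derivations of commutative algebras. -/
theorem derivation_aeval {σ A : Type*} [Fintype σ] [CommRing A] [Algebra ℂ A]
    (D : Derivation ℂ A A) (g : σ → A) (p : MvPolynomial σ ℂ) :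
    D (aeval g p) = ∑ i, aeval g (pderiv i p) * D (g i) := by
  classical
  induction p using MvPolynomial.induction_on with
  | C c => simp
  | add p q hp hq => simp [hp, hq, add_mul, Finset.sum_add_distrib]
  | mul_X p j hp =>
    simp only [map_mul, aeval_X, Derivation.leibniz, smul_eq_mul, hp, map_add, pderiv_X,
      Finset.mul_sum, add_mul, Finset.sum_add_distrib]
    congr 1
    · simp [Pi.single_apply]
    · exact Finset.sum_congr rfl fun i _ => by ring

theorem lieDeriv_apply (F : VField n) (p : MvPolynomial (Fin n) ℂ) :
    lieDeriv F p = ∑ i, F i * pderiv i p := by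
  have := derivation_aeval (lieDeriv F) X p
  rw [aeval_X_left, AlgHom.id_apply] at this
  rw [this]
  exact Finset.sum_congr rfl fun i _ => by simp [lieDeriv, mul_comm]

theorem coeff_X_mul_pderiv (i : Fin n) (p : MvPolynomial (Fin n) ℂ) (a : Fin n →₀ ℕ) :
    coeff a (X i * pderiv i p) = a i * coeff a p := by
  classical
  induction p using MvPolynomial.induction_on' with
  | add p q hp hq => simp [hp, hq, mul_add]
  | monomial m c =>
    rw [X_mul_pderiv_monomial, coeff_smul, coeff_monomial]
    split_ifs with h
    · subst h
      simp
    · simp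

/-- `F` has the diagonal linear part `∑ λᵢ xᵢ ∂ᵢ` at the stationary point `0`. -/
def HasDiagonalPart (F : VField n) (ev : Fin n → ℂ) : Prop :=
  ∀ i, F i - C (ev i) * X i ∈ 𝔪 ^ 2

theorem coeff_diagonal (ev : Fin n → ℂ) (p : MvPolynomial (Fin n) ℂ) (a : Fin n →₀ ℕ) :
    coeff a (∑ i, C (ev i) * X i * pderiv i p) = weight ev a * coeff a p := by
  rw [coeff_sum, weight, Finset.sum_mul]
  refine Finset.sum_congr rfl fun i _ => ?_
  rw [mul_assoc, coeff_C_mul, coeff_X_mul_pderiv]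
  ring

/-! ### Approximate invariant hypersurfaces and division by them -/

section Local

variable {F : VField n} {ev : Fin n → ℂ}

/-- The nonlinear part of `F` gains two orders and the derivative loses one, so on lowest forms
`X_F` acts as the diagonal operator, with the monomials as eigenvectors. -/
theorem HasDiagonalPart.lieDeriv_sub_mem (hF : HasDiagonalPart F ev)
    {p : MvPolynomial (Fin n) ℂ} {k : ℕ} (hp : p ∈ 𝔪 ^ k) :
    lieDeriv F p - ∑ i, C (ev i) * X i * pderiv i p ∈ 𝔪 ^ (k + 1) := by
  rw [lieDeriv_apply, ← Finset.sum_sub_distrib]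
  refine Ideal.sum_mem _ fun i _ => ?_
  rw [← sub_mul]
  cases k with
  | zero => exact mem_pow_of_le (by omega) (Ideal.mul_mem_right _ _ (hF i))
  | succ k =>
    have := mul_mem_pow_add (hF i) (pderiv_mem i hp)
    exact mem_pow_of_le (by omega) this

theorem HasDiagonalPart.coeff_lieDeriv (hF : HasDiagonalPart F ev)
    {p : MvPolynomial (Fin n) ℂ} {k : ℕ} (hp : p ∈ 𝔪 ^ k) {a : Fin n →₀ ℕ}
    (ha : a.degree ≤ k) : coeff a (lieDeriv F p) = weight ev a * coeff a p := by
  rw [coeff_eq_of_sub_mem (hF.lieDeriv_sub_mem hp) (by omega), coeff_diagonal]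

theorem HasDiagonalPart.lieDeriv_mem (hF : HasDiagonalPart F ev)
    {p : MvPolynomial (Fin n) ℂ} {k : ℕ} (hp : p ∈ 𝔪 ^ k) : lieDeriv F p ∈ 𝔪 ^ k := by
  refine (mem_pow_idealOfVars_iff' _ _).2 fun a ha => ?_
  rw [hF.coeff_lieDeriv hp ha.le, coeff_eq_zero_of_mem hp ha, mul_zero]

theorem mul_sub_X_mul_mem {y q : MvPolynomial (Fin n) ℂ} {j : Fin n} (hy : y - X j ∈ 𝔪 ^ 2)
    {k : ℕ} (hq : q ∈ 𝔪 ^ k) : y * q - X j * q ∈ 𝔪 ^ (k + 2) := by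
  rw [← sub_mul, add_comm]
  exact mul_mem_pow_add hy hq

theorem mul_mem_succ {y q : MvPolynomial (Fin n) ℂ} {j : Fin n} (hy : y - X j ∈ 𝔪 ^ 2)
    {k : ℕ} (hq : q ∈ 𝔪 ^ k) : y * q ∈ 𝔪 ^ (k + 1) := by
  have := add_mem (mem_pow_of_le (Nat.le_succ _) (mul_sub_X_mul_mem hy hq)) (X_mul_mem j hq)
  simpa using this

/-- Bootstrapping: once `q ∈ 𝔪 ^ i`, the products `y * q` and `X j * q` agree modulo `𝔪 ^ (i + 2)`,
and division by the variable `X j` improves the order of `q` by one. -/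
theorem mem_of_mul_mem_succ {y q : MvPolynomial (Fin n) ℂ} {j : Fin n} (hy : y - X j ∈ 𝔪 ^ 2)
    {k : ℕ} (hq : y * q ∈ 𝔪 ^ (k + 1)) : q ∈ 𝔪 ^ k := by
  suffices h : ∀ i ≤ k, q ∈ 𝔪 ^ i from h k le_rfl
  intro i
  induction i with
  | zero => simp
  | succ i ih =>
    intro hi
    have h1 := mul_sub_X_mul_mem hy (ih (by omega))
    have h2 := sub_mem (mem_pow_of_le (show i + 2 ≤ k + 1 by omega) hq) h1
    rw [sub_sub_cancel] at h2
    exact mem_of_X_mul_mem h2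

/-- The lowest form of a multiple of `y` is a multiple of `x_j`, so it has no monomial free of
`x_j`. -/
theorem coeff_mul_eq_zero {y q : MvPolynomial (Fin n) ℂ} {j : Fin n} (hy : y - X j ∈ 𝔪 ^ 2)
    {k : ℕ} (hq : y * q ∈ 𝔪 ^ k) {a : Fin n →₀ ℕ} (ha : a.degree ≤ k) (haj : a j = 0) :
    coeff a (y * q) = 0 := by
  classical
  have h : ∀ r : MvPolynomial (Fin n) ℂ, coeff a (X j * r) = 0 := by
    intro r
    rw [coeff_X_mul', if_neg (by simpa using haj)]
  have hq' : q ∈ 𝔪 ^ (k - 1) := by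
    cases k with
    | zero => simp
    | succ k => exact mem_of_mul_mem_succ hy hq
  rw [coeff_eq_of_sub_mem (mul_sub_X_mul_mem hy hq') (by omega), h]

/-- The homological equation that has to be solved in each degree. -/
theorem exists_solve_homological {j : Fin n}
    (hres : ∀ a : Fin n →₀ ℕ, a j = 0 → 1 ≤ a.degree → weight ev a ≠ ev j)
    {k : ℕ} {ρ : MvPolynomial (Fin n) ℂ} (hρ : ρ ∈ 𝔪 ^ (k + 1)) :
    ∃ h ∈ 𝔪 ^ (k + 1), ∃ u ∈ 𝔪 ^ k,
      ρ + (∑ i, C (ev i) * X i * pderiv i h) - C (ev j) * h - u * X j = 0 := by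
  classical
  rw [mem_pow_idealOfVars_iff'] at hρ
  -- Monomials free of `x_j` are removed by a change `h` of the hypersurface, at the cost of the
  -- nonzero divisor `weight ev a - ev j`; monomials divisible by `x_j` are absorbed into the
  -- cofactor through `u`.
  let h : MvPolynomial (Fin n) ℂ := ∑ a ∈ ρ.support,
    if a j = 0 then monomial a (-(coeff a ρ / (weight ev a - ev j))) else 0
  let u : MvPolynomial (Fin n) ℂ := ∑ a ∈ ρ.support,
    if a j = 0 then 0 else monomial (a - Finsupp.single j 1) (coeff a ρ)
  have hh : ∀ a, coeff a h =
      if a j = 0 then -(coeff a ρ / (weight ev a - ev j)) else 0 := by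
    intro a
    simp only [h, coeff_sum]
    rw [Finset.sum_eq_single a]
    · split_ifs <;> simp
    · intro b _ hb
      split_ifs <;> simp [hb]
    · intro ha
      rw [notMem_support_iff] at ha
      split_ifs <;> simp [ha]
  have hu : u * X j = ∑ a ∈ ρ.support, if a j = 0 then 0 else monomial a (coeff a ρ) := by
    simp only [u, Finset.sum_mul]
    refine Finset.sum_congr rfl fun a _ => ?_
    split_ifs with haj
    · simp
    · rw [X, monomial_mul, mul_one, Finsupp.sub_add_single_one_cancel haj]
  have hu' : ∀ a, coeff a (u * X j) = if a j = 0 then 0 else coeff a ρ := by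
    intro a
    simp only [hu, coeff_sum]
    rw [Finset.sum_eq_single a]
    · split_ifs <;> simp
    · intro b _ hb
      split_ifs <;> simp [hb]
    · intro ha
      rw [notMem_support_iff] at ha
      split_ifs <;> simp [ha]
  refine ⟨h, ?_, u, ?_, ?_⟩
  · refine (mem_pow_idealOfVars_iff' _ _).2 fun a ha => ?_
    rw [hh, hρ a ha]
    simp
  · apply mem_of_X_mul_mem (j := j)
    rw [mul_comm]
    refine (mem_pow_idealOfVars_iff' _ _).2 fun a ha => ?_
    rw [hu', hρ a ha]
    simp
  · ext a
    rw [coeff_sub, coeff_sub, coeff_add, coeff_diagonal, coeff_C_mul, hu', hh, coeff_zero]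
    split_ifs with haj
    · by_cases ha : 1 ≤ a.degree
      · have := sub_ne_zero.2 (hres a haj ha)
        field_simp
        ring
      · rw [hρ a (by omega)]
        simp
    · ring

/-- Approximate invariant hypersurface tangent to `x_j = 0`. -/
theorem HasDiagonalPart.exists_hypersurface (hF : HasDiagonalPart F ev) {j : Fin n}
    (hres : ∀ a : Fin n →₀ ℕ, a j = 0 → 1 ≤ a.degree → weight ev a ≠ ev j) (N : ℕ) :
    ∃ y κ : MvPolynomial (Fin n) ℂ, y - X j ∈ 𝔪 ^ 2 ∧ κ - C (ev j) ∈ 𝔪 ∧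
      lieDeriv F y - κ * y ∈ 𝔪 ^ N := by
  suffices h : ∃ y κ : MvPolynomial (Fin n) ℂ, y - X j ∈ 𝔪 ^ 2 ∧ κ - C (ev j) ∈ 𝔪 ∧
      lieDeriv F y - κ * y ∈ 𝔪 ^ (N + 2) by
    obtain ⟨y, κ, h1, h2, h3⟩ := h
    exact ⟨y, κ, h1, h2, mem_pow_of_le (by omega) h3⟩
  induction N with
  | zero =>
    refine ⟨X j, C (ev j), by simp, by simp, ?_⟩
    have := hF j
    simpa [lieDeriv] using this
  | succ N ih =>
    obtain ⟨y, κ, h1, h2, h3⟩ := ih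
    obtain ⟨h, hh, u, hu, heq⟩ := exists_solve_homological hres h3
    refine ⟨y + h, κ + u, ?_, ?_, ?_⟩
    · rw [add_sub_right_comm]
      exact add_mem h1 (mem_pow_of_le (by omega) hh)
    · rw [add_sub_right_comm]
      refine add_mem h2 ?_
      have := mem_pow_of_le (show 1 ≤ N + 1 by omega) hu
      rwa [pow_one] at this
    · have e1 := hF.lieDeriv_sub_mem hh
      have e2 : (κ - C (ev j)) * h ∈ 𝔪 ^ (N + 2 + 1) := by
        rw [pow_succ']
        exact Ideal.mul_mem_mul h2 hh
      have e3 : u * (y - X j) ∈ 𝔪 ^ (N + 2 + 1) :=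
        mem_pow_of_le (by omega) (mul_mem_pow_add hu h1)
      have e4 : u * h ∈ 𝔪 ^ (N + 2 + 1) :=
        mem_pow_of_le (by omega) (mul_mem_pow_add hu hh)
      have e5 := sub_mem (sub_mem (sub_mem e1 e2) e3) e4
      convert e5 using 1
      rw [map_add]
      linear_combination heq

theorem exists_split_X (j : Fin n) {k : ℕ} {ρ : MvPolynomial (Fin n) ℂ} (hρ : ρ ∈ 𝔪 ^ (k + 1)) :
    ∃ s ∈ 𝔪 ^ k, ∀ a : Fin n →₀ ℕ, a j ≠ 0 → coeff a (ρ - X j * s) = 0 := by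
  classical
  refine ⟨ρ.divMonomial (Finsupp.single j 1), ?_, ?_⟩
  · refine (mem_pow_idealOfVars_iff' _ _).2 fun a ha => ?_
    rw [coeff_divMonomial]
    apply coeff_eq_zero_of_mem hρ
    rw [map_add, Finsupp.degree_single]
    omega
  · intro a ha
    rw [coeff_sub, coeff_X_mul', if_pos (by simpa using ha), coeff_divMonomial, add_comm,
      Finsupp.sub_add_single_one_cancel ha, sub_self]

/-- Division of a semi-invariant by an invariant hypersurface, modulo a power of `𝔪`. -/
theorem HasDiagonalPart.exists_quotient (hF : HasDiagonalPart F ev) {j : Fin n} {N l : ℕ}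
    {y κy p κ : MvPolynomial (Fin n) ℂ} (hy : y - X j ∈ 𝔪 ^ 2)
    (hyN : lieDeriv F y - κy * y ∈ 𝔪 ^ N) (hp : lieDeriv F p - κ * p ∈ 𝔪 ^ N)
    (hpl : p ∈ 𝔪 ^ (l + 1)) (hl : l + 1 ≤ N)
    (hres : ∀ a : Fin n →₀ ℕ, a j = 0 → l + 1 ≤ a.degree → weight ev a ≠ coeff 0 κ) :
    ∃ q ∈ 𝔪 ^ l, p - y * q ∈ 𝔪 ^ N := by
  suffices h : ∀ k, l + 1 + k ≤ N → ∃ q ∈ 𝔪 ^ l, p - y * q ∈ 𝔪 ^ (l + 1 + k) by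
    obtain ⟨q, hq, h⟩ := h (N - (l + 1)) (by omega)
    exact ⟨q, hq, by rwa [show l + 1 + (N - (l + 1)) = N by omega] at h⟩
  intro k
  induction k with
  | zero => exact fun _ => ⟨0, by simp, by simpa using hpl⟩
  | succ k ih =>
    intro hk
    obtain ⟨q, hq, hqk⟩ := ih (by omega)
    rw [add_right_comm] at hqk
    obtain ⟨s, hs, hsplit⟩ := exists_split_X j hqk
    have hd : p - y * (q + s) = (p - y * q - X j * s) - (y * s - X j * s) := by ring
    -- Replacing `X j * s` by `y * s` changes only higher orders, so the degree `l + k + 1` part of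
    -- the new remainder `ρ` involves only monomials free of `x_j`.
    have hys := mul_sub_X_mul_mem hy hs
    set ρ := p - y * (q + s) with hρ
    have hρk : ρ ∈ 𝔪 ^ (l + k + 1) := by
      rw [hd]
      exact sub_mem (sub_mem hqk (X_mul_mem j hs)) (mem_pow_of_le (by omega) hys)
    have hρ0 : ∀ a : Fin n →₀ ℕ, a.degree = l + k + 1 → a j ≠ 0 → coeff a ρ = 0 := by
      intro a ha haj
      rw [hd, coeff_sub, hsplit a haj, coeff_eq_zero_of_mem hys (by omega), sub_zero]
    refine ⟨q + s, add_mem hq (mem_pow_of_le (by omega) hs), ?_⟩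
    rw [show l + 1 + (k + 1) = (l + k + 1) + 1 by omega]
    refine (mem_pow_succ_iff hρk).2 fun a ha => ?_
    by_cases haj : a j = 0
    swap
    · exact hρ0 a ha haj
    -- Modulo `𝔪 ^ N`, `X_F ρ - κ ρ` is a multiple of `y`, so its coefficient at an exponent `a` of
    -- degree `l + k + 1` free of `x_j` vanishes. This coefficient is `(weight ev a - κ(0))` times
    -- that of `ρ`, and the first factor is nonzero.
    have ht : lieDeriv F ρ - κ * ρ + y * (κy * (q + s) + lieDeriv F (q + s) - κ * (q + s))
        ∈ 𝔪 ^ N := by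
      have h1 := sub_mem hp (Ideal.mul_mem_right (q + s) _ hyN)
      convert h1 using 1
      rw [hρ, map_sub, Derivation.leibniz, smul_eq_mul, smul_eq_mul]
      ring
    have hw : lieDeriv F ρ - κ * ρ ∈ 𝔪 ^ (l + k + 1) :=
      sub_mem (hF.lieDeriv_mem hρk) (Ideal.mul_mem_left _ _ hρk)
    set t := κy * (q + s) + lieDeriv F (q + s) - κ * (q + s)
    have hyt : y * t ∈ 𝔪 ^ (l + k + 1) := by
      have := sub_mem (mem_pow_of_le (show l + k + 1 ≤ N by omega) ht) hw
      rwa [add_sub_cancel_left] at this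
    have h2 := coeff_eq_zero_of_mem ht (show a.degree < N by omega)
    rw [coeff_add, coeff_mul_eq_zero hy hyt ha.le haj, add_zero, coeff_sub,
      hF.coeff_lieDeriv hρk ha.le, coeff_mul_of_mem _ hρk ha.le, ← sub_mul, mul_eq_zero] at h2
    exact h2.resolve_left (sub_ne_zero.2 (hres a haj (by omega)))

theorem exists_lowest_exponent {p : MvPolynomial (Fin n) ℂ} (hp : p ≠ 0) :
    ∃ a : Fin n →₀ ℕ, coeff a p ≠ 0 ∧ p ∈ 𝔪 ^ a.degree := by
  obtain ⟨a, ha, hmin⟩ := Finset.exists_min_image p.support Finsupp.degree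
    (Finset.nonempty_iff_ne_empty.2 (by simpa using hp))
  exact ⟨a, mem_support_iff.1 ha, (mem_pow_idealOfVars_iff _ _).2 hmin⟩

/-- A nonzero polynomial free of `x_j` does not lie in all the ideals `(y) + 𝔪 ^ N`. -/
theorem not_mem_hypersurface {y r q : MvPolynomial (Fin n) ℂ} {j : Fin n} (hy : y - X j ∈ 𝔪 ^ 2)
    {b : Fin n →₀ ℕ} (hb : coeff b r ≠ 0) (hr : r ∈ 𝔪 ^ b.degree) (hbj : b j = 0)
    (hq : r - y * q ∈ 𝔪 ^ (b.degree + 1)) : False := by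
  have h1 := sub_mem hr (mem_pow_of_le (Nat.le_succ _) hq)
  rw [sub_sub_cancel] at h1
  apply hb
  rw [coeff_eq_of_sub_mem hq (by omega), coeff_mul_eq_zero hy h1 le_rfl hbj]

theorem HasDiagonalPart.weight_eq_of_semiinvariant (hF : HasDiagonalPart F ev)
    {p κ : MvPolynomial (Fin n) ℂ} (hp : lieDeriv F p = κ * p) {a : Fin n →₀ ℕ}
    (ha : coeff a p ≠ 0) (hpa : p ∈ 𝔪 ^ a.degree) : coeff 0 κ = weight ev a := by
  have h := congrArg (coeff a) hp
  rw [hF.coeff_lieDeriv hpa le_rfl, coeff_mul_of_mem _ hpa le_rfl] at h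
  exact (mul_right_cancel₀ ha h).symm

/-- This is the form in which nonresonance enters: it makes the divisors nonzero both for the
construction of `y` and for division by `y`. -/
theorem Nonresonant.weight_ne (hev : Nonresonant ev) {a b : Fin n →₀ ℕ} {j : Fin n}
    (ha : a j ≠ 0) (hb : b j = 0) (hab : a.degree ≤ b.degree) : weight ev b ≠ weight ev a := by
  intro h
  have := hev a b h.symm hab j
  omega

theorem Nonresonant.weight_ne_single (hev : Nonresonant ev) (j : Fin n) (a : Fin n →₀ ℕ)
    (ha : a j = 0) (h1 : 1 ≤ a.degree) : weight ev a ≠ ev j := by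
  rw [← weight_single ev j]
  exact hev.weight_ne (j := j) (by simp) ha (by simpa using h1)

end Local

end PolyVF

end

noncomputable section

namespace PolyVF

/-! ### Elimination of a variable -/

/-- By Gauss's lemma an irreducible `p` of positive degree stays irreducible, and still does not
divide `q`, over the fraction field. So `p` and `q` are coprime there and their resultant, which
lies in the ideal `(p, q)`, is nonzero. In degree `0`, `p` itself is the constant. -/
theorem _root_.Polynomial.exists_combination_eq_C {R : Type*} [CommRing R] [IsDomain R]
    [UniqueFactorizationMonoid R] {p q : Polynomial R} (hp : Irreducible p) (hpq : ¬ p ∣ q) :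
    ∃ (u v : Polynomial R) (r : R), r ≠ 0 ∧ u * p + v * q = Polynomial.C r := by
  obtain ⟨_⟩ : Nonempty (NormalizedGCDMonoid R) := inferInstance
  by_cases hdeg : p.natDegree = 0
  · rw [Polynomial.natDegree_eq_zero] at hdeg
    obtain ⟨r, rfl⟩ := hdeg
    exact ⟨1, 0, r, fun h => hp.ne_zero (by simp [h]), by simp⟩
  have hprim := hp.isPrimitive hdeg
  let K := FractionRing R
  let φ := algebraMap R K
  have hφ : Function.Injective φ := IsFractionRing.injective R K
  have hirr : Irreducible (p.map φ) :=
    (hprim.irreducible_iff_irreducible_map_fraction_map (K := K)).1 hp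
  have hcop : IsCoprime (p.map φ) (q.map φ) := by
    refine (hirr.coprime_iff_not_dvd).2 ?_
    rintro ⟨g, hg⟩
    have hg' : g ∈ Polynomial.lifts φ := by
      rw [← hprim.map_mul_mem_lifts_iff, ← hg]
      exact (Polynomial.mem_lifts _).2 ⟨q, rfl⟩
    obtain ⟨g', rfl⟩ := (Polynomial.mem_lifts _).1 hg'
    exact hpq ⟨g', Polynomial.map_injective φ hφ (by rw [hg, Polynomial.map_mul])⟩
  obtain ⟨u, v, -, -, huv⟩ := Polynomial.exists_mul_add_mul_eq_C_resultant p q le_rfl le_rfl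
    (Or.inl hdeg)
  refine ⟨u, v, _, fun h => ?_, by rw [← huv]; ring⟩
  have h2 := Polynomial.resultant_ne_zero _ _ hcop
  rw [Polynomial.natDegree_map_eq_of_injective hφ, Polynomial.natDegree_map_eq_of_injective hφ,
    Polynomial.resultant_map_map, h, map_zero] at h2
  exact h2 rfl

/-- Elimination of `x_j`: the preceding lemma over the polynomial ring in the other variables. The
result cannot be approximated by multiples of `y`, by `not_mem_hypersurface`. -/
theorem exists_combination_free {σ : Type*} [DecidableEq σ] {p q : MvPolynomial σ ℂ}
    (hp : Prime p) (hpq : ¬ p ∣ q) (j : σ) :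
    ∃ u v : MvPolynomial σ ℂ, u * p + v * q ≠ 0 ∧
      ∀ b : σ →₀ ℕ, coeff b (u * p + v * q) ≠ 0 → b j = 0 := by
  let e : MvPolynomial σ ℂ ≃ₐ[ℂ] Polynomial (MvPolynomial {i // i ≠ j} ℂ) :=
    (renameEquiv ℂ (Equiv.optionSubtypeNe j).symm).trans (optionEquivLeft ℂ {i // i ≠ j})
  have hC : ∀ r, e.symm (Polynomial.C r) = rename Subtype.val r := by
    intro r
    rw [AlgEquiv.symm_apply_eq]
    induction r using MvPolynomial.induction_on with
    | C c => simp [e, optionEquivLeft_C]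
    | add p q hp hq => rw [map_add, map_add, map_add, hp, hq]
    | mul_X p i hp =>
      rw [map_mul, map_mul, map_mul, hp]
      simp [e, i.2]
  have hpe : Irreducible (e p) := (MulEquiv.irreducible_iff e).2 hp.irreducible
  have hpqe : ¬ e p ∣ e q := fun h => hpq ((map_dvd_iff e).1 h)
  obtain ⟨u, v, r, hr, h⟩ := Polynomial.exists_combination_eq_C hpe hpqe
  have h' : e.symm u * p + e.symm v * q = rename Subtype.val r := by
    rw [← hC, ← h]
    simp
  refine ⟨e.symm u, e.symm v, ?_, ?_⟩
  · rw [h']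
    exact (map_ne_zero_iff _ (rename_injective _ Subtype.val_injective)).2 hr
  · intro b hb
    rw [h'] at hb
    by_contra hbj
    have hv : j ∈ (rename Subtype.val r : MvPolynomial σ ℂ).vars :=
      (mem_vars_iff_mem_support _).2 ⟨b, mem_support_iff.2 hb, by simpa using hbj⟩
    have := vars_rename _ _ hv
    simp at this

/-! ### Exponents of prime semi-invariants -/

section Local

variable {n : ℕ} {F : VField n} {ev : Fin n → ℂ}

/-- The ideal of polynomials without constant term. -/
local notation "𝔪" => idealOfVars (Fin n) ℂ

/-- Distinct prime semi-invariants have exponents with disjoint supports. -/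
theorem HasDiagonalPart.dvd_of_common_exponent (hF : HasDiagonalPart F ev) (hev : Nonresonant ev)
    {p q κp κq : MvPolynomial (Fin n) ℂ} (hp : lieDeriv F p = κp * p) (hq : lieDeriv F q = κq * q)
    {a b : Fin n →₀ ℕ} (ha : coeff a p ≠ 0) (hpa : p ∈ 𝔪 ^ a.degree)
    (hb : coeff b q ≠ 0) (hqb : q ∈ 𝔪 ^ b.degree) {j : Fin n} (haj : a j ≠ 0) (hbj : b j ≠ 0)
    (hprime : Prime p) : p ∣ q := by
  by_contra hpq
  obtain ⟨u, v, hr, hrj⟩ := exists_combination_free hprime hpq j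
  obtain ⟨c, hc, hrc⟩ := exists_lowest_exponent hr
  -- The order must exceed `c.degree`, to see the lowest term of the eliminant, and be at least the
  -- orders of `p` and `q`, for the division.
  obtain ⟨y, κ, hy, -, hyN⟩ := hF.exists_hypersurface (hev.weight_ne_single j)
    (c.degree + 1 + a.degree + b.degree)
  have key : ∀ {p κp : MvPolynomial (Fin n) ℂ} {a : Fin n →₀ ℕ}, lieDeriv F p = κp * p →
      coeff a p ≠ 0 → p ∈ 𝔪 ^ a.degree → a j ≠ 0 → ∀ N, a.degree ≤ N → lieDeriv F y - κ * y ∈ 𝔪 ^ N →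
      ∃ s, p - y * s ∈ 𝔪 ^ N := by
    intro p κp a hp ha hpa haj N hN hyN
    have hdeg : a.degree - 1 + 1 = a.degree := by
      have := Finsupp.le_degree j a
      omega
    obtain ⟨s, -, hs⟩ := hF.exists_quotient (l := a.degree - 1) hy hyN
      (p := p) (κ := κp) (by simp [hp]) (by rwa [hdeg]) (by omega) (by
        intro b hb hab
        rw [hF.weight_eq_of_semiinvariant hp ha hpa]
        exact hev.weight_ne haj hb (by omega))
    exact ⟨s, hs⟩
  obtain ⟨s, hs⟩ := key hp ha hpa haj _ (by omega) hyN
  obtain ⟨t, ht⟩ := key hq hb hqb hbj _ (by omega) hyN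
  refine not_mem_hypersurface (q := u * s + v * t) hy hc hrc (hrj c hc) ?_
  have := add_mem (Ideal.mul_mem_left _ u hs) (Ideal.mul_mem_left _ v ht)
  refine mem_pow_of_le (show _ ≤ c.degree + 1 + a.degree + b.degree by omega) ?_
  convert this using 1
  ring

theorem totalDegree_pderiv_lt {p : MvPolynomial (Fin n) ℂ} {i : Fin n} (hne : pderiv i p ≠ 0) :
    (pderiv i p).totalDegree < p.totalDegree := by
  obtain ⟨b, hb, hbd⟩ := Finset.exists_mem_eq_sup (pderiv i p).support
    (Finset.nonempty_iff_ne_empty.2 (by simpa using hne)) (fun b => b.sum fun _ e => e)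
  have h2 : coeff (b + Finsupp.single i 1) p ≠ 0 := by
    rw [mem_support_iff, coeff_pderiv] at hb
    exact left_ne_zero_of_mul hb
  have h3 := le_totalDegree (mem_support_iff.2 h2)
  rw [Finsupp.sum_add_index' (by simp) (by simp), Finsupp.sum_single_index rfl] at h3
  have h4 : (pderiv i p).totalDegree = b.sum fun _ e => e := hbd
  omega

/-- Otherwise all derivatives vanish for degree reasons, and in characteristic zero `p` is constant.
-/
theorem exists_not_dvd_pderiv {p : MvPolynomial (Fin n) ℂ} (hp : Prime p) :
    ∃ i, ¬ p ∣ pderiv i p := by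
  by_contra! h
  have h0 : ∀ i, pderiv i p = 0 := by
    intro i
    by_contra hne
    exact (totalDegree_le_of_dvd_of_isDomain (h i) hne).not_gt (totalDegree_pderiv_lt hne)
  have hC : p = C (coeff 0 p) := by
    ext a
    rw [coeff_C]
    split_ifs with ha
    · rw [ha]
    · obtain ⟨i, hi⟩ := Finsupp.ne_iff.1 (Ne.symm ha)
      have h1 := congrArg (coeff (a - Finsupp.single i 1)) (h0 i)
      rw [coeff_pderiv, Finsupp.sub_add_single_one_cancel hi, coeff_zero, mul_eq_zero] at h1
      exact h1.resolve_right (Nat.cast_add_one_ne_zero _)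
  have hc : coeff 0 p ≠ 0 := fun h => hp.ne_zero (by rw [hC, h, C_0])
  apply hp.not_isUnit
  rw [hC]
  exact (isUnit_iff_ne_zero.2 hc).map C

/-- The exponent of a prime semi-invariant is squarefree. -/
theorem HasDiagonalPart.exponent_le_one (hF : HasDiagonalPart F ev) (hev : Nonresonant ev)
    {p κp : MvPolynomial (Fin n) ℂ} (hp : lieDeriv F p = κp * p)
    {a : Fin n →₀ ℕ} (ha : coeff a p ≠ 0) (hpa : p ∈ 𝔪 ^ a.degree)
    (hprime : Prime p) (j : Fin n) : a j ≤ 1 := by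
  by_contra! haj
  obtain ⟨i, hi⟩ := exists_not_dvd_pderiv hprime
  obtain ⟨u, v, hr, hrj⟩ := exists_combination_free hprime hi j
  obtain ⟨c, hc, hrc⟩ := exists_lowest_exponent hr
  obtain ⟨N, hN⟩ : ∃ N, N = c.degree + 1 + a.degree := ⟨_, rfl⟩
  obtain ⟨y, κ, hy, hκ, hyN⟩ := hF.exists_hypersurface (hev.weight_ne_single j) (N + 1)
  obtain ⟨l, hl⟩ : ∃ l, a.degree = l + 2 := ⟨a.degree - 2, by
    have := Finsupp.le_degree j a
    omega⟩
  have hw := hF.weight_eq_of_semiinvariant hp ha hpa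
  obtain ⟨s, hsl, hs⟩ := hF.exists_quotient (l := l + 1) hy hyN
      (p := p) (κ := κp) (by simp [hp]) (by rwa [← hl]) (by omega) (by
        intro b hb hab
        rw [hw]
        exact hev.weight_ne (by omega) hb (by omega))
  -- The quotient `s` is again an approximate semi-invariant; cancelling `y` costs one order, hence
  -- the start with `N + 1`. Its cofactor has at `0` the weight of `a` lowered by one at `j`, still
  -- positive at `j`, so a second division by `y` is possible.
  have hs' : lieDeriv F s - (κp - κ) * s ∈ 𝔪 ^ N := by
    refine mem_of_mul_mem_succ hy ?_
    have h1 : lieDeriv F (p - y * s) - κp * (p - y * s) ∈ 𝔪 ^ (N + 1) :=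
      sub_mem (hF.lieDeriv_mem hs) (Ideal.mul_mem_left _ _ hs)
    have h2 := add_mem h1 (Ideal.mul_mem_right s _ hyN)
    rw [← neg_mem_iff]
    convert h2 using 1
    rw [map_sub, Derivation.leibniz, hp, smul_eq_mul, smul_eq_mul]
    ring
  have hκ0 : coeff 0 κ = ev j := by
    have := coeff_eq_of_sub_mem (by rwa [pow_one]) (show (0 : Fin n →₀ ℕ).degree < 1 by simp)
      (p := κ) (q := C (ev j))
    simpa using this
  obtain ⟨t, -, ht⟩ := hF.exists_quotient (l := l) hy (mem_pow_of_le (Nat.le_succ _) hyN)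
      hs' hsl (by omega) (by
        intro b hb hab
        have e : a = (a - Finsupp.single j 1) + Finsupp.single j 1 :=
          (Finsupp.sub_add_single_one_cancel (by omega)).symm
        have e1 := congrArg (weight ev) e
        have e2 := congrArg Finsupp.degree e
        rw [weight_add, weight_single] at e1
        rw [map_add, Finsupp.degree_single] at e2
        rw [coeff_sub, hw, hκ0, e1, add_sub_cancel_right]
        refine hev.weight_ne (j := j) ?_ hb (by omega)
        simp
        omega)
  have hpy : p - y * (y * t) ∈ 𝔪 ^ (N + 1) := by
    have := add_mem hs (mul_mem_succ hy ht)
    convert this using 1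
    ring
  -- As `p` is `y ^ 2 * t` modulo `𝔪 ^ (N + 1)`, its derivative is a multiple of `y` modulo `𝔪 ^ N`;
  -- so is the eliminant of `p` and `pderiv i p`.
  have hdy := pderiv_mem i hpy
  refine not_mem_hypersurface (q := u * (y * t) + v * (pderiv i y * t + pderiv i (y * t))) hy hc hrc
    (hrj c hc) ?_
  have := add_mem (Ideal.mul_mem_left _ u (mem_pow_of_le (Nat.le_succ _) hpy))
    (Ideal.mul_mem_left _ v hdy)
  refine mem_pow_of_le (show _ ≤ N by omega) ?_
  convert this using 1
  rw [map_sub, Derivation.leibniz (pderiv i) y (y * t)]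
  simp only [smul_eq_mul]
  ring

end Local

end PolyVF

end

noncomputable section

namespace PolyVF

/-! ### Rational relations between eigenvalues -/

section Relations

variable {n : ℕ} {ev : Fin n → ℂ}

/-- All rational relations between the `evⱼ` are multiples of one relation with positive
coefficients. -/
def RelationsSpannedByPos {n : ℕ} (ev : Fin n → ℂ) (k : Fin n → ℕ) : Prop :=
  (∀ i, 0 < k i) ∧ ∀ c : Fin n → ℚ, ∑ i, (c i : ℂ) * ev i = 0 → ∃ t : ℚ, ∀ i, c i = t * k i

/-- By rank-nullity the space of rational relations is a line, and `k` is a nonzero vector on it. -/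
theorem relationsSpannedByPos_of_finrank
    (hdim : Module.finrank ℚ (Submodule.span ℚ (Set.range ev)) + 1 = n)
    {k : Fin n → ℕ} (hk : ∀ i, 0 < k i) (hrel : ∑ i, (k i : ℂ) * ev i = 0) :
    RelationsSpannedByPos ev k := by
  refine ⟨hk, fun c hc => ?_⟩
  have hr := Fintype.range_linearCombination ℚ ev
  have hrank := LinearMap.finrank_range_add_finrank_ker (Fintype.linearCombination ℚ ev)
  rw [hr, Module.finrank_fin_fun] at hrank
  have hker : Module.finrank ℚ (LinearMap.ker (Fintype.linearCombination ℚ ev)) = 1 := by omega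
  have hmem : ∀ c : Fin n → ℚ, ∑ i, (c i : ℂ) * ev i = 0 →
      c ∈ LinearMap.ker (Fintype.linearCombination ℚ ev) := by
    intro c hc
    rw [LinearMap.mem_ker, Fintype.linearCombination_apply, ← hc]
    exact Finset.sum_congr rfl fun i _ => by rw [Rat.smul_def]
  have hkm := hmem (fun i => (k i : ℚ)) (by simpa using hrel)
  have hne : (⟨_, hkm⟩ : LinearMap.ker (Fintype.linearCombination ℚ ev)) ≠ 0 := by
    intro h
    have h1 : (fun i => (k i : ℚ)) = 0 := congrArg Subtype.val h
    have h2 := congrFun h1 ⟨0, by omega⟩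
    have := hk ⟨0, by omega⟩
    simp at h2
    omega
  obtain ⟨t, ht⟩ := (finrank_eq_one_iff_of_nonzero' _ hne).1 hker ⟨c, hmem c hc⟩
  refine ⟨t, fun i => ?_⟩
  have := congrFun (congrArg Subtype.val ht) i
  simpa using this.symm

theorem sum_cast_sub_mul {a b : Fin n →₀ ℕ} (h : weight ev a = weight ev b) :
    ∑ i, (((b i : ℚ) - a i : ℚ) : ℂ) * ev i = 0 := by
  simp only [weight] at h
  push_cast
  simp only [sub_mul, Finset.sum_sub_distrib]
  exact sub_eq_zero.2 h.symm

theorem eq_zero_of_linearIndependent (h : LinearIndependent ℚ ev) (c : Fin n → ℚ)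
    (hc : ∑ i, (c i : ℂ) * ev i = 0) (i : Fin n) : c i = 0 := by
  refine Fintype.linearIndependent_iff.1 h c ?_ i
  rw [← hc]
  exact Finset.sum_congr rfl fun i _ => by rw [Rat.smul_def]

theorem nonresonant_of_linearIndependent (h : LinearIndependent ℚ ev) : Nonresonant ev := by
  intro a b hab _ i
  have := eq_zero_of_linearIndependent h _ (sum_cast_sub_mul hab) i
  rw [sub_eq_zero] at this
  exact_mod_cast this.ge

/-- Exponents of equal weight differ by `t * k`; as all `k i` are positive, the comparison of
degrees fixes the sign of `t`. -/
theorem RelationsSpannedByPos.nonresonant {k : Fin n → ℕ} (h : RelationsSpannedByPos ev k) :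
    Nonresonant ev := by
  intro a b hab hdeg
  obtain ⟨t, ht⟩ := h.2 _ (sum_cast_sub_mul hab)
  have ht0 : ∀ i, 0 ≤ (t * k i : ℚ) := by
    by_contra! hcon
    obtain ⟨i₀, hi₀⟩ := hcon
    have hneg : t < 0 := by
      by_contra! h0
      exact absurd hi₀ (not_lt.2 (by positivity))
    have hlt : ∑ i, (b i : ℚ) < ∑ i, (a i : ℚ) := by
      apply Finset.sum_lt_sum_of_nonempty ⟨i₀, Finset.mem_univ _⟩
      intro i _
      have h1 := ht i
      have h2 : t * k i < 0 := mul_neg_of_neg_of_pos hneg (by exact_mod_cast h.1 i)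
      linarith
    rw [Finsupp.degree_eq_sum, Finsupp.degree_eq_sum] at hdeg
    exact absurd hdeg (not_le.2 (by exact_mod_cast hlt))
  intro i
  have h1 := ht i
  have h2 := ht0 i
  have : (a i : ℚ) ≤ b i := by linarith
  exact_mod_cast this

theorem Nonresonant.injective (hev : Nonresonant ev) : Function.Injective ev := by
  intro i j hij
  have := hev (Finsupp.single i 1) (Finsupp.single j 1)
    (by rw [weight_single, weight_single, hij]) (by simp) i
  by_contra hne
  rw [Finsupp.single_eq_same, Finsupp.single_apply, if_neg (Ne.symm hne)] at this
  omega

end Relations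

/-! ### Multiplicities at a stationary point with diagonal linear part -/

section Local

variable {n : ℕ} {F : VField n} {ev : Fin n → ℂ}

/-- The ideal of polynomials without constant term. -/
local notation "𝔪" => idealOfVars (Fin n) ℂ

/-- Let `a i` be a lowest exponent of `ψ i`. Then `htr` is the relation with `c j = ∑ d i * a i j -
1`. If `ψ i` vanishes at `0`, some `a i j` is nonzero; it equals `1` and no other `ψ i'` contributes
at `j`. -/
theorem HasDiagonalPart.exists_exponents (hF : HasDiagonalPart F ev) (hev : Nonresonant ev)
    {ι : Type*} [Fintype ι] {ψ κ : ι → MvPolynomial (Fin n) ℂ}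
    (hψ : ∀ i, lieDeriv F (ψ i) = κ i * ψ i) (hprime : ∀ i, IsUnit (ψ i) ∨ Prime (ψ i))
    (hrel : ∀ i i', i ≠ i' → IsRelPrime (ψ i) (ψ i')) (d : ι → ℚ)
    (htr : ∑ i, (d i : ℂ) * coeff 0 (κ i) = ∑ j, ev j) :
    ∃ c : Fin n → ℚ, ∑ j, (c j : ℂ) * ev j = 0 ∧
      ∀ i, coeff 0 (ψ i) = 0 → ∃ j, c j = d i - 1 := by
  have h0 : ∀ i, ψ i ≠ 0 := by
    intro i
    rcases hprime i with h | h
    · exact h.ne_zero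
    · exact h.ne_zero
  choose a ha hpa using fun i => exists_lowest_exponent (h0 i)
  have hprime' : ∀ i j, a i j ≠ 0 → Prime (ψ i) := by
    intro i j haj
    refine (hprime i).resolve_left fun hu => ?_
    have h1 : coeff 0 (ψ i) = 0 := by
      apply coeff_eq_zero_of_mem (hpa i)
      have := Finsupp.le_degree j (a i)
      simp
      omega
    have h2 := hu.map (constantCoeff (R := ℂ) (σ := Fin n))
    rw [constantCoeff_eq, h1] at h2
    exact not_isUnit_zero h2
  have huniq : ∀ i i' j, a i j ≠ 0 → a i' j ≠ 0 → i = i' := by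
    intro i i' j hi hi'
    by_contra hne
    have hdvd := hF.dvd_of_common_exponent hev (hψ i) (hψ i') (ha i) (hpa i) (ha i') (hpa i') hi hi'
      (hprime' i j hi)
    exact (hprime' i j hi).not_isUnit (hrel i i' hne dvd_rfl hdvd)
  have hone : ∀ i j, a i j ≠ 0 → a i j = 1 := by
    intro i j hi
    have := hF.exponent_le_one hev (hψ i) (ha i) (hpa i) (hprime' i j hi) j
    omega
  refine ⟨fun j => ∑ i, d i * a i j - 1, ?_, ?_⟩
  · have h1 : ∀ i, coeff 0 (κ i) = weight ev (a i) := fun i =>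
      hF.weight_eq_of_semiinvariant (hψ i) (ha i) (hpa i)
    simp only [h1, weight, Finset.mul_sum] at htr
    rw [Finset.sum_comm] at htr
    push_cast
    simp only [sub_mul, Finset.sum_sub_distrib, one_mul, Finset.sum_mul]
    rw [sub_eq_zero, ← htr]
    exact Finset.sum_congr rfl fun j _ => Finset.sum_congr rfl fun i _ => by ring
  · intro i hi
    have hai : a i ≠ 0 := fun h => ha i (by rw [h, hi])
    obtain ⟨j, hj⟩ := Finsupp.ne_iff.1 hai
    refine ⟨j, ?_⟩
    simp only
    rw [Finset.sum_eq_single i, hone i j hj]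
    · simp
    · intro i' _ hne
      have : a i' j = 0 := by
        by_contra h
        exact hne (huniq i' i j h hj)
      simp [this]
    · simp

end Local

/-! ### Linear changes of coordinates -/

section Conjugation

variable {n : ℕ}

/-- The substitution `p ↦ p ∘ A`. -/
def subst {n : ℕ} (A : Matrix (Fin n) (Fin n) ℂ) :
    MvPolynomial (Fin n) ℂ →ₐ[ℂ] MvPolynomial (Fin n) ℂ :=
  aeval fun k => ∑ l, C (A k l) * X l

theorem subst_subst (A B : Matrix (Fin n) (Fin n) ℂ) (p : MvPolynomial (Fin n) ℂ) :
    subst A (subst B p) = subst (B * A) p := by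
  suffices h : (subst A).comp (subst B) = subst (B * A) from DFunLike.congr_fun h p
  ext k : 1
  simp only [subst, AlgHom.comp_apply, aeval_X, map_sum, map_mul, algHom_C, algebraMap_eq,
    Matrix.mul_apply, Finset.mul_sum, Finset.sum_mul]
  rw [Finset.sum_comm]
  exact Finset.sum_congr rfl fun i _ => Finset.sum_congr rfl fun j _ => by ring

theorem subst_one (p : MvPolynomial (Fin n) ℂ) : subst (1 : Matrix (Fin n) (Fin n) ℂ) p = p := by
  have : subst (1 : Matrix (Fin n) (Fin n) ℂ) = AlgHom.id ℂ _ := by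
    ext k : 1
    simp [subst, Matrix.one_apply]
  rw [this, AlgHom.id_apply]

theorem eval_subst (A : Matrix (Fin n) (Fin n) ℂ) (x : Fin n → ℂ) (p : MvPolynomial (Fin n) ℂ) :
    eval x (subst A p) = eval (A.mulVec x) p := by
  induction p using MvPolynomial.induction_on with
  | C c => simp [subst]
  | add p q hp hq => simp [hp, hq]
  | mul_X p i hp =>
    rw [map_mul, map_mul, map_mul, hp]
    simp [subst, Matrix.mulVec, dotProduct]

/-- An invertible linear substitution as an automorphism. -/
def substEquiv {n : ℕ} (T : Matrix (Fin n) (Fin n) ℂ) (hT : IsUnit T.det) :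
    MvPolynomial (Fin n) ℂ ≃ₐ[ℂ] MvPolynomial (Fin n) ℂ :=
  AlgEquiv.ofAlgHom (subst T⁻¹) (subst T)
    (AlgHom.ext fun p => by
      rw [AlgHom.comp_apply, subst_subst, Matrix.mul_nonsing_inv _ hT, subst_one, AlgHom.id_apply])
    (AlgHom.ext fun p => by
      rw [AlgHom.comp_apply, subst_subst, Matrix.nonsing_inv_mul _ hT, subst_one, AlgHom.id_apply])

theorem substEquiv_apply (T : Matrix (Fin n) (Fin n) ℂ) (hT : IsUnit T.det)
    (p : MvPolynomial (Fin n) ℂ) : substEquiv T hT p = subst T⁻¹ p := rfl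

theorem conjugate_apply (T : Matrix (Fin n) (Fin n) ℂ) (f : VField n) (i : Fin n) :
    conjugate T f i = ∑ j, C (T i j) * subst T⁻¹ (f j) := rfl

theorem lieDeriv_conjugate (T : Matrix (Fin n) (Fin n) ℂ) (hT : IsUnit T.det) (f : VField n)
    (p : MvPolynomial (Fin n) ℂ) :
    lieDeriv (conjugate T f) (subst T⁻¹ p) = subst T⁻¹ (lieDeriv f p) := by
  have h : ∀ k, lieDeriv (conjugate T f) (∑ l, C (T⁻¹ k l) * X l) = subst T⁻¹ (f k) := by
    intro k
    have h1 : ∀ l, lieDeriv (conjugate T f) (C (T⁻¹ k l) * X l) =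
        ∑ j, C (T⁻¹ k l * T l j) * subst T⁻¹ (f j) := by
      intro l
      rw [← smul_eq_C_mul, Derivation.map_smul, lieDeriv, mkDerivation_X, conjugate_apply,
        smul_eq_C_mul, Finset.mul_sum]
      exact Finset.sum_congr rfl fun j _ => by rw [C_mul, mul_assoc]
    rw [map_sum, Finset.sum_congr rfl fun l _ => h1 l, Finset.sum_comm]
    simp only [← Finset.sum_mul, ← map_sum, ← Matrix.mul_apply, Matrix.nonsing_inv_mul _ hT]
    simp [Matrix.one_apply]
  rw [subst, derivation_aeval, lieDeriv_apply, map_sum]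
  refine Finset.sum_congr rfl fun k _ => ?_
  rw [h, map_mul, mul_comm]
  rfl

theorem pderiv_subst (A : Matrix (Fin n) (Fin n) ℂ) (i : Fin n) (p : MvPolynomial (Fin n) ℂ) :
    pderiv i (subst A p) = ∑ k, subst A (pderiv k p) * C (A k i) := by
  rw [subst, derivation_aeval]
  refine Finset.sum_congr rfl fun k _ => ?_
  congr 1
  simp [Pi.single_apply]

theorem pderiv_conjugate (T : Matrix (Fin n) (Fin n) ℂ) (f : VField n) (i j : Fin n) :
    pderiv j (conjugate T f i) =
      ∑ k, ∑ l, C (T i l) * subst T⁻¹ (pderiv k (f l)) * C (T⁻¹ k j) := by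
  rw [conjugate_apply, map_sum, Finset.sum_comm]
  refine Finset.sum_congr rfl fun l _ => ?_
  rw [pderiv_C_mul, pderiv_subst, Finset.mul_sum]
  exact Finset.sum_congr rfl fun k _ => by ring

theorem jacobianAtZero_conjugate (T : Matrix (Fin n) (Fin n) ℂ) (f : VField n) :
    jacobianAtZero (conjugate T f) = T * jacobianAtZero f * T⁻¹ := by
  ext i j
  simp only [jacobianAtZero, Matrix.of_apply, Matrix.mul_apply, pderiv_conjugate, map_sum, map_mul,
    eval_C, eval_subst, Matrix.mulVec_zero, Finset.sum_mul]

theorem divergence_conjugate (T : Matrix (Fin n) (Fin n) ℂ) (hT : IsUnit T.det) (f : VField n) :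
    divergence (conjugate T f) = subst T⁻¹ (divergence f) := by
  have h : ∀ k l, ∑ i, C (T i l) * subst T⁻¹ (pderiv k (f l)) * C (T⁻¹ k i) =
      if k = l then subst T⁻¹ (pderiv k (f l)) else 0 := by
    intro k l
    have h1 := congrFun (congrFun (Matrix.nonsing_inv_mul T hT) k) l
    rw [Matrix.mul_apply, Matrix.one_apply] at h1
    have h2 : ∑ i, C (T i l) * subst T⁻¹ (pderiv k (f l)) * C (T⁻¹ k i) =
        C (∑ i, T⁻¹ k i * T i l) * subst T⁻¹ (pderiv k (f l)) := by
      rw [map_sum, Finset.sum_mul]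
      exact Finset.sum_congr rfl fun i _ => by rw [C_mul]; ring
    rw [h2, h1]
    split_ifs <;> simp
  simp only [divergence, pderiv_conjugate, map_sum]
  rw [Finset.sum_comm]
  refine Finset.sum_congr rfl fun k _ => ?_
  rw [Finset.sum_comm]
  simp [h]

theorem totalDegree_aeval_le {σ τ : Type*} (g : σ → MvPolynomial τ ℂ)
    (hg : ∀ i, (g i).totalDegree ≤ 1) (p : MvPolynomial σ ℂ) :
    (aeval g p).totalDegree ≤ p.totalDegree := by
  conv_lhs => rw [p.as_sum, map_sum]
  refine totalDegree_finsetSum_le fun a ha => ?_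
  refine le_trans ?_ (le_totalDegree ha)
  rw [aeval_monomial, algebraMap_eq]
  refine (totalDegree_mul _ _).trans ?_
  rw [totalDegree_C, zero_add]
  refine (totalDegree_finsetProd _ _).trans ?_
  refine Finset.sum_le_sum fun i _ => (totalDegree_pow _ _).trans ?_
  simpa using Nat.mul_le_mul_left (a i) (hg i)

theorem totalDegree_subst_le (A : Matrix (Fin n) (Fin n) ℂ) (p : MvPolynomial (Fin n) ℂ) :
    (subst A p).totalDegree ≤ p.totalDegree := by
  refine totalDegree_aeval_le _ (fun k => totalDegree_finsetSum_le fun l _ => ?_) p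
  refine (totalDegree_mul _ _).trans ?_
  simp [totalDegree_C, totalDegree_X]

theorem totalDegree_subst_inv (T : Matrix (Fin n) (Fin n) ℂ) (hT : IsUnit T.det)
    (p : MvPolynomial (Fin n) ℂ) : (subst T⁻¹ p).totalDegree = p.totalDegree := by
  refine le_antisymm (totalDegree_subst_le _ _) ?_
  have h := totalDegree_subst_le T (subst T⁻¹ p)
  rwa [subst_subst, Matrix.nonsing_inv_mul _ hT, subst_one] at h

theorem totalDegree_conjugate_le (T : Matrix (Fin n) (Fin n) ℂ) {f : VField n} {m : ℕ}
    (hf : ∀ i, (f i).totalDegree ≤ m) (i : Fin n) : (conjugate T f i).totalDegree ≤ m := by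
  rw [conjugate_apply]
  refine totalDegree_finsetSum_le fun l _ => (totalDegree_mul _ _).trans ?_
  rw [totalDegree_C, zero_add]
  exact (totalDegree_subst_le _ _).trans (hf l)

theorem value_conjugate_zero (T : Matrix (Fin n) (Fin n) ℂ) {f : VField n} (hf : value f 0 = 0) :
    value (conjugate T f) 0 = 0 := by
  funext i
  have h : ∀ j, eval 0 (f j) = 0 := fun j => congrFun hf j
  simp only [value, conjugate_apply, map_sum, map_mul, eval_subst, Matrix.mulVec_zero, h, mul_zero,
    Finset.sum_const_zero, Pi.zero_apply]

end Conjugation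

end PolyVF

end

noncomputable section

namespace PolyVF

/-! ### Diagonalization and the local conclusion -/

section Diagonalization

variable {n : ℕ}

theorem exists_diagonalization {B : Matrix (Fin n) (Fin n) ℂ} {ev : Fin n → ℂ}
    (hB : IsEigenvalueList B ev) (hev : Function.Injective ev) :
    ∃ T : Matrix (Fin n) (Fin n) ℂ, IsUnit T.det ∧ T * B * T⁻¹ = Matrix.diagonal ev := by
  have hv : ∀ i, ∃ v : Fin n → ℂ, v ≠ 0 ∧ B.mulVec v = ev i • v := by
    intro i
    have h1 : (Matrix.scalar (Fin n) (ev i) - B).det = 0 := by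
      rw [← Matrix.eval_charpoly, hB, Polynomial.eval_prod]
      exact Finset.prod_eq_zero (Finset.mem_univ i) (by simp)
    obtain ⟨v, hv, h⟩ := Matrix.exists_mulVec_eq_zero_iff.2 h1
    refine ⟨v, hv, ?_⟩
    rw [Matrix.sub_mulVec, sub_eq_zero] at h
    rw [← h]
    ext k
    simp [Matrix.scalar_apply, Matrix.mulVec_diagonal]
  choose v hv hBv using hv
  have hli : LinearIndependent ℂ v := by
    refine Module.End.eigenvectors_linearIndependent' (Matrix.toLin' B) ev hev v fun i => ?_
    rw [Module.End.hasEigenvector_iff, Module.End.mem_eigenspace_iff, Matrix.toLin'_apply]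
    exact ⟨hBv i, hv i⟩
  let P : Matrix (Fin n) (Fin n) ℂ := Matrix.of fun i j => v j i
  have hP : IsUnit P := Matrix.linearIndependent_cols_iff_isUnit.1 hli
  have hPd : IsUnit P.det := (Matrix.isUnit_iff_isUnit_det _).1 hP
  have hBP : B * P = P * Matrix.diagonal ev := by
    ext i j
    rw [Matrix.mul_diagonal]
    have := congrFun (hBv j) i
    simp only [Pi.smul_apply, smul_eq_mul] at this
    rw [mul_comm]
    exact this
  refine ⟨P⁻¹, (Matrix.isUnit_nonsing_inv_det_iff).2 hPd, ?_⟩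
  rw [Matrix.nonsing_inv_nonsing_inv _ hPd, mul_assoc, hBP, ← mul_assoc,
    Matrix.nonsing_inv_mul _ hPd, one_mul]

theorem hasDiagonalPart_of_jacobian {F : VField n} {ev : Fin n → ℂ} (h0 : value F 0 = 0)
    (hJ : jacobianAtZero F = Matrix.diagonal ev) : HasDiagonalPart F ev := by
  intro i
  refine (mem_pow_idealOfVars_iff' _ _).2 fun a ha => ?_
  have hc : ∀ p : MvPolynomial (Fin n) ℂ, eval 0 p = coeff 0 p := fun p => by
    rw [← constantCoeff_eq, eval_zero]
  rcases Nat.lt_succ_iff_lt_or_eq.1 ha with h | h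
  · have : a = 0 := by
      rw [← Finsupp.degree_eq_zero_iff]
      omega
    have h1 : eval 0 (F i) = 0 := congrFun h0 i
    rw [hc] at h1
    simp [this, h1]
  · have ha1 : a ∈ {d : Fin n →₀ ℕ | d.degree = 1} := h
    rw [← Finsupp.range_single_one] at ha1
    obtain ⟨j, rfl⟩ := ha1
    have h1 := congrFun (congrFun hJ i) j
    rw [jacobianAtZero, Matrix.of_apply, hc, coeff_pderiv, zero_add, Matrix.diagonal_apply] at h1
    rw [coeff_sub, coeff_C_mul, coeff_X]
    rcases eq_or_ne i j with rfl | hij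
    · simpa [sub_eq_zero] using h1
    · rw [if_neg hij] at h1
      simpa [Finsupp.single_left_inj, hij] using h1

theorem trace_eq_sum_of_conj {B T : Matrix (Fin n) (Fin n) ℂ} {ev : Fin n → ℂ} (hT : IsUnit T.det)
    (h : T * B * T⁻¹ = Matrix.diagonal ev) : B.trace = ∑ i, ev i := by
  rw [← Matrix.trace_diagonal, ← h, Matrix.trace_mul_comm, ← mul_assoc,
    Matrix.nonsing_inv_mul _ hT, one_mul]

theorem eval_divergence (F : VField n) : eval 0 (divergence F) = (jacobianAtZero F).trace := by
  simp [divergence, jacobianAtZero, Matrix.trace]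

/-- Semi-invariants at a stationary point whose eigenvalues satisfy a nonresonance condition. -/
theorem exists_relation_of_semiinvariants {F : VField n} (h0 : value F 0 = 0) {ev : Fin n → ℂ}
    (hev : IsEigenvalueList (jacobianAtZero F) ev) (hnr : Nonresonant ev)
    {ι : Type*} [Fintype ι] {ψ κ : ι → MvPolynomial (Fin n) ℂ}
    (hψ : ∀ i, lieDeriv F (ψ i) = κ i * ψ i) (hprime : ∀ i, IsUnit (ψ i) ∨ Prime (ψ i))
    (hrel : ∀ i i', i ≠ i' → IsRelPrime (ψ i) (ψ i')) (d : ι → ℚ)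
    (htr : ∑ i, C (d i : ℂ) * κ i = divergence F) :
    ∃ c : Fin n → ℚ, ∑ j, (c j : ℂ) * ev j = 0 ∧
      ∀ i, eval 0 (ψ i) = 0 → ∃ j, c j = d i - 1 := by
  obtain ⟨T, hT, hTB⟩ := exists_diagonalization hev hnr.injective
  have hc : ∀ p : MvPolynomial (Fin n) ℂ, coeff 0 (subst T⁻¹ p) = eval 0 p := fun p => by
    rw [← constantCoeff_eq, ← eval_zero, eval_subst, Matrix.mulVec_zero]
  have hF := hasDiagonalPart_of_jacobian (value_conjugate_zero T h0)
    ((jacobianAtZero_conjugate T F).trans hTB)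
  have := hF.exists_exponents hnr (ψ := fun i => subst T⁻¹ (ψ i)) (κ := fun i => subst T⁻¹ (κ i))
    (fun i => by rw [lieDeriv_conjugate T hT, hψ, map_mul])
    (fun i => by
      rw [← substEquiv_apply T hT, MulEquiv.isUnit_map, MulEquiv.prime_iff (substEquiv T hT)]
      exact hprime i)
    (fun i i' h => by
      intro p h1 h2
      rw [← substEquiv_apply T hT, ← (substEquiv T hT).apply_symm_apply p, map_dvd_iff] at h1 h2
      have := (hrel i i' h h1 h2).map (substEquiv T hT)
      rwa [(substEquiv T hT).apply_symm_apply] at this) d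
    (by
      rw [← trace_eq_sum_of_conj hT hTB, ← eval_divergence, ← htr, map_sum]
      exact Finset.sum_congr rfl fun i _ => by rw [hc, map_mul, eval_C])
  obtain ⟨c, hc1, hc2⟩ := this
  exact ⟨c, hc1, fun i hi => hc2 i (by rw [hc, hi])⟩

theorem eq_one_of_eigCond1 {F : VField n} (h0 : value F 0 = 0)
    (hE : EigCond1 (jacobianAtZero F))
    {ι : Type*} [Fintype ι] {ψ κ : ι → MvPolynomial (Fin n) ℂ}
    (hψ : ∀ i, lieDeriv F (ψ i) = κ i * ψ i) (hprime : ∀ i, IsUnit (ψ i) ∨ Prime (ψ i))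
    (hrel : ∀ i i', i ≠ i' → IsRelPrime (ψ i) (ψ i')) (d : ι → ℚ)
    (htr : ∑ i, C (d i : ℂ) * κ i = divergence F) {i : ι} (hi : eval 0 (ψ i) = 0) : d i = 1 := by
  obtain ⟨ev, hev, hli⟩ := hE
  obtain ⟨c, hc, h⟩ := exists_relation_of_semiinvariants h0 hev
    (nonresonant_of_linearIndependent hli) hψ hprime hrel d htr
  obtain ⟨j, hj⟩ := h i hi
  rw [eq_zero_of_linearIndependent hli c hc j] at hj
  exact (sub_eq_zero.1 hj.symm)

/-- The relation `c` is `t * k` with all `k j` positive. One exponent known to be `1` gives a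
vanishing `c j₀`, so `t = 0`. In the application `i₀` is the hyperplane at infinity. -/
theorem eq_one_of_eigCond2 {F : VField n} (h0 : value F 0 = 0)
    (hE : EigCond2 (jacobianAtZero F))
    {ι : Type*} [Fintype ι] {ψ κ : ι → MvPolynomial (Fin n) ℂ}
    (hψ : ∀ i, lieDeriv F (ψ i) = κ i * ψ i) (hprime : ∀ i, IsUnit (ψ i) ∨ Prime (ψ i))
    (hrel : ∀ i i', i ≠ i' → IsRelPrime (ψ i) (ψ i')) (d : ι → ℚ)
    (htr : ∑ i, C (d i : ℂ) * κ i = divergence F) {i₀ : ι} (hi₀ : eval 0 (ψ i₀) = 0)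
    (hd : d i₀ = 1) {i : ι} (hi : eval 0 (ψ i) = 0) : d i = 1 := by
  obtain ⟨ev, hev, hdim, k, hk, hrelk⟩ := hE
  have hpos := relationsSpannedByPos_of_finrank hdim hk hrelk
  obtain ⟨c, hc, h⟩ := exists_relation_of_semiinvariants h0 hev hpos.nonresonant
    hψ hprime hrel d htr
  obtain ⟨t, ht⟩ := hpos.2 c hc
  obtain ⟨j₀, hj₀⟩ := h i₀ hi₀
  obtain ⟨j, hj⟩ := h i hi
  have hk0 : (k j₀ : ℚ) ≠ 0 := by exact_mod_cast (hk j₀).ne'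
  rw [hd, sub_self, ht, mul_eq_zero, or_iff_left hk0] at hj₀
  rw [ht, hj₀, zero_mul] at hj
  exact (sub_eq_zero.1 hj.symm)

end Diagonalization

end PolyVF

end

noncomputable section

namespace PolyVF

/-! ### Homogenization followed by a substitution -/

section HomSubst

variable {σ τ : Type*}

/-- Homogenize `p` to degree `d`, substitute `g` for the variables and `w` for the homogenizing
variable. -/
def homSubst (d : ℕ) (g : σ → MvPolynomial τ ℂ) (w : MvPolynomial τ ℂ) (p : MvPolynomial σ ℂ) :
    MvPolynomial τ ℂ :=
  ∑ j ∈ Finset.range (d + 1), aeval g (homogeneousComponent j p) * w ^ (d - j)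

theorem sum_homogeneousComponent_of_le {p : MvPolynomial σ ℂ} {d : ℕ} (hd : p.totalDegree ≤ d) :
    ∑ j ∈ Finset.range (d + 1), homogeneousComponent j p = p := by
  conv_rhs => rw [← sum_homogeneousComponent p]
  symm
  apply Finset.sum_subset
  · exact Finset.range_subset_range.2 (by omega)
  · intro j _ hj
    rw [Finset.mem_range] at hj
    exact homogeneousComponent_eq_zero _ _ (by omega)

theorem _root_.MvPolynomial.IsHomogeneous.aeval_mul {K : Type*} [CommRing K] [Algebra ℂ K]
    {p : MvPolynomial σ ℂ} {j : ℕ} (hp : p.IsHomogeneous j) (c : K) (g : σ → K) :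
    MvPolynomial.aeval (fun i => c * g i) p = c ^ j * MvPolynomial.aeval g p := by
  rw [p.as_sum, map_sum, map_sum, Finset.mul_sum]
  refine Finset.sum_congr rfl fun a ha => ?_
  have hdeg := hp.degree_eq_sum_deg_support ha
  rw [aeval_monomial, aeval_monomial]
  simp only [Finsupp.prod, mul_pow, Finset.prod_mul_distrib, Finset.prod_pow_eq_pow_sum]
  rw [hdeg]
  ring

/-- In a field, homogenizing and substituting is a power of `w` times the ring homomorphism `x ↦ g /
w`. This makes the identities for `star` and `unstar` computations in `AlgFun`. -/
theorem map_homSubst {K : Type*} [Field K] [Algebra ℂ K] (H : MvPolynomial τ ℂ →ₐ[ℂ] K)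
    {d : ℕ} (g : σ → MvPolynomial τ ℂ) {w : MvPolynomial τ ℂ} (hw : H w ≠ 0)
    {p : MvPolynomial σ ℂ} (hd : p.totalDegree ≤ d) :
    H (homSubst d g w p) = H w ^ d * aeval (fun i => H (g i) / H w) p := by
  conv_rhs => rw [← sum_homogeneousComponent_of_le hd, map_sum, Finset.mul_sum]
  rw [homSubst, map_sum]
  refine Finset.sum_congr rfl fun j hj => ?_
  rw [Finset.mem_range] at hj
  have h1 : (fun i => H (g i) / H w) = fun i => (H w)⁻¹ * H (g i) := by
    funext i
    rw [div_eq_inv_mul]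
  have h2 : H (aeval g (homogeneousComponent j p)) =
      aeval (fun i => H (g i)) (homogeneousComponent j p) := by
    rw [← AlgHom.comp_apply]
    congr 1
    ext i : 1
    simp
  rw [h1, (homogeneousComponent_isHomogeneous j p).aeval_mul, map_mul, map_pow, h2, ← mul_assoc,
    inv_pow, mul_comm, pow_sub₀ _ hw (by omega)]

theorem totalDegree_homSubst_le {d : ℕ} {g : σ → MvPolynomial τ ℂ} {w : MvPolynomial τ ℂ}
    (hg : ∀ i, (g i).totalDegree ≤ 1) (hw : w.totalDegree ≤ 1) (p : MvPolynomial σ ℂ) :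
    (homSubst d g w p).totalDegree ≤ d := by
  refine totalDegree_finsetSum_le fun j hj => (totalDegree_mul _ _).trans ?_
  rw [Finset.mem_range] at hj
  have h1 := (totalDegree_aeval_le g hg (homogeneousComponent j p)).trans
    (homogeneousComponent_isHomogeneous j p).totalDegree_le
  have h2 := (totalDegree_pow w (d - j)).trans (Nat.mul_le_mul_left _ hw)
  omega

end HomSubst

/-! ### The Poincaré transform of polynomials -/

section Star

variable {k : ℕ}

/-- The substitution `x₁ ↦ 1`, `x_{i+1} ↦ zᵢ`. -/
def starVars (k : ℕ) : Fin (k + 1) → MvPolynomial (Fin (k + 1)) ℂ :=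
  Fin.cons 1 fun i : Fin k => X i.castSucc

/-- The substitution `zᵢ ↦ x_{i+1}` for `i < n` and `zₙ ↦ 1`. -/
def unstarVars (k : ℕ) : Fin (k + 1) → MvPolynomial (Fin (k + 1)) ℂ :=
  Fin.snoc (α := fun _ => MvPolynomial (Fin (k + 1)) ℂ) (fun i : Fin k => X i.succ) 1

/-- The Poincaré transform of a polynomial of degree at most `d`. -/
def star (d : ℕ) (p : MvPolynomial (Fin (k + 1)) ℂ) : MvPolynomial (Fin (k + 1)) ℂ :=
  homSubst d (starVars k) (X (Fin.last k)) p

/-- The inverse of the Poincaré transform of polynomials of degree at most `d`. -/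
def unstar (d : ℕ) (p : MvPolynomial (Fin (k + 1)) ℂ) : MvPolynomial (Fin (k + 1)) ℂ :=
  homSubst d (unstarVars k) (X 0) p

theorem starVars_zero : starVars k 0 = 1 := rfl

theorem starVars_succ (i : Fin k) : starVars k i.succ = X i.castSucc := rfl

theorem unstarVars_last : unstarVars k (Fin.last k) = 1 := by simp [unstarVars]

theorem unstarVars_castSucc (i : Fin k) : unstarVars k i.castSucc = X i.succ := by
  simp [unstarVars]

theorem totalDegree_star_le (d : ℕ) (p : MvPolynomial (Fin (k + 1)) ℂ) :
    (star d p).totalDegree ≤ d := by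
  refine totalDegree_homSubst_le (fun i => ?_) (totalDegree_X _).le p
  refine Fin.cases ?_ (fun i => ?_) i
  · simp [starVars_zero]
  · simp [starVars_succ, totalDegree_X]

theorem totalDegree_unstar_le (d : ℕ) (p : MvPolynomial (Fin (k + 1)) ℂ) :
    (unstar d p).totalDegree ≤ d := by
  refine totalDegree_homSubst_le (fun i => ?_) (totalDegree_X _).le p
  refine Fin.lastCases ?_ (fun i => ?_) i
  · simp [unstarVars_last]
  · simp [unstarVars_castSucc, totalDegree_X]

/-- Polynomials as algebraic functions. -/
def toAlgFun (n : ℕ) : MvPolynomial (Fin n) ℂ →ₐ[ℂ] AlgFun n :=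
  IsScalarTower.toAlgHom ℂ (MvPolynomial (Fin n) ℂ) (AlgFun n)

theorem toAlgFun_injective (n : ℕ) : Function.Injective (toAlgFun n) := by
  have h := IsScalarTower.algebraMap_eq (MvPolynomial (Fin n) ℂ)
    (FractionRing (MvPolynomial (Fin n) ℂ)) (AlgFun n)
  rw [toAlgFun, IsScalarTower.coe_toAlgHom', h]
  exact (algebraMap (FractionRing (MvPolynomial (Fin n) ℂ)) (AlgFun n)).injective.comp
    (IsFractionRing.injective _ _)

theorem toAlgFun_X_ne_zero {n : ℕ} (i : Fin n) : toAlgFun n (X i) ≠ 0 :=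
  (map_ne_zero_iff _ (toAlgFun_injective n)).2 (X_ne_zero i)

theorem lieDerivAlg_toAlgFun {n : ℕ} (f : VField n) (p : MvPolynomial (Fin n) ℂ) :
    lieDerivAlg f (toAlgFun n p) = toAlgFun n (lieDeriv f p) :=
  lieDerivAlg_algebraMap f p

/-- The birational substitution `x₁ ↦ 1 / zₙ`, `x_{i+1} ↦ zᵢ / zₙ`. -/
def starHom (k : ℕ) : MvPolynomial (Fin (k + 1)) ℂ →ₐ[ℂ] AlgFun (k + 1) :=
  aeval fun i => toAlgFun (k + 1) (starVars k i) / toAlgFun (k + 1) (X (Fin.last k))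

/-- The birational substitution `zₙ ↦ 1 / x₁`, `zᵢ ↦ x_{i+1} / x₁`. -/
def unstarHom (k : ℕ) : MvPolynomial (Fin (k + 1)) ℂ →ₐ[ℂ] AlgFun (k + 1) :=
  aeval fun i => toAlgFun (k + 1) (unstarVars k i) / toAlgFun (k + 1) (X 0)

theorem toAlgFun_star {d : ℕ} {p : MvPolynomial (Fin (k + 1)) ℂ} (hd : p.totalDegree ≤ d) :
    toAlgFun (k + 1) (star d p) = toAlgFun (k + 1) (X (Fin.last k)) ^ d * starHom k p :=
  map_homSubst _ _ (toAlgFun_X_ne_zero _) hd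

theorem toAlgFun_unstar {d : ℕ} {p : MvPolynomial (Fin (k + 1)) ℂ} (hd : p.totalDegree ≤ d) :
    toAlgFun (k + 1) (unstar d p) = toAlgFun (k + 1) (X 0) ^ d * unstarHom k p :=
  map_homSubst _ _ (toAlgFun_X_ne_zero _) hd

theorem aeval_toAlgFun_X {n : ℕ} (p : MvPolynomial (Fin n) ℂ) :
    aeval (fun i => toAlgFun n (X i)) p = toAlgFun n p := by
  suffices h : aeval (fun i => toAlgFun n (X i)) = toAlgFun n from DFunLike.congr_fun h p
  ext i : 1
  simp

theorem unstarHom_star {d : ℕ} {p : MvPolynomial (Fin (k + 1)) ℂ} (hd : p.totalDegree ≤ d) :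
    unstarHom k (star d p) = (toAlgFun (k + 1) (X 0))⁻¹ ^ d * toAlgFun (k + 1) p := by
  have h0 := toAlgFun_X_ne_zero (0 : Fin (k + 1))
  have h1 : unstarHom k (X (Fin.last k)) = (toAlgFun (k + 1) (X 0))⁻¹ := by
    simp [unstarHom, unstarVars_last]
  have h2 : (fun i => unstarHom k (starVars k i) / unstarHom k (X (Fin.last k))) =
      fun i => toAlgFun (k + 1) (X i) := by
    funext i
    rw [h1, div_inv_eq_mul]
    refine Fin.cases ?_ (fun i => ?_) i
    · simp [starVars_zero]
    · rw [starVars_succ, unstarHom, aeval_X, unstarVars_castSucc, div_mul_cancel₀ _ h0]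
  rw [star, map_homSubst (unstarHom k) _ (by rw [h1]; exact inv_ne_zero h0) hd, h2, h1,
    aeval_toAlgFun_X]

theorem starHom_unstar {d : ℕ} {p : MvPolynomial (Fin (k + 1)) ℂ} (hd : p.totalDegree ≤ d) :
    starHom k (unstar d p) =
      (toAlgFun (k + 1) (X (Fin.last k)))⁻¹ ^ d * toAlgFun (k + 1) p := by
  have h0 := toAlgFun_X_ne_zero (Fin.last k)
  have h1 : starHom k (X 0) = (toAlgFun (k + 1) (X (Fin.last k)))⁻¹ := by
    simp [starHom, starVars_zero]
  have h2 : (fun i => starHom k (unstarVars k i) / starHom k (X 0)) =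
      fun i => toAlgFun (k + 1) (X i) := by
    funext i
    rw [h1, div_inv_eq_mul]
    refine Fin.lastCases ?_ (fun i => ?_) i
    · simp [unstarVars_last]
    · rw [unstarVars_castSucc, starHom, aeval_X, starVars_succ, div_mul_cancel₀ _ h0]
  rw [unstar, map_homSubst (starHom k) _ (by rw [h1]; exact inv_ne_zero h0) hd, h2, h1,
    aeval_toAlgFun_X]

theorem star_mul {d e : ℕ} {p q : MvPolynomial (Fin (k + 1)) ℂ} (hp : p.totalDegree ≤ d)
    (hq : q.totalDegree ≤ e) : star (d + e) (p * q) = star d p * star e q := by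
  apply toAlgFun_injective
  rw [map_mul, toAlgFun_star hp, toAlgFun_star hq,
    toAlgFun_star ((totalDegree_mul _ _).trans (add_le_add hp hq)), map_mul]
  ring

theorem unstar_mul {d e : ℕ} {p q : MvPolynomial (Fin (k + 1)) ℂ} (hp : p.totalDegree ≤ d)
    (hq : q.totalDegree ≤ e) : unstar (d + e) (p * q) = unstar d p * unstar e q := by
  apply toAlgFun_injective
  rw [map_mul, toAlgFun_unstar hp, toAlgFun_unstar hq,
    toAlgFun_unstar ((totalDegree_mul _ _).trans (add_le_add hp hq)), map_mul]
  ring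

theorem unstar_star {d : ℕ} {p : MvPolynomial (Fin (k + 1)) ℂ} (hp : p.totalDegree ≤ d) :
    unstar d (star d p) = p := by
  apply toAlgFun_injective
  rw [toAlgFun_unstar (totalDegree_star_le d p), unstarHom_star hp, ← mul_assoc, ← mul_pow,
    mul_inv_cancel₀ (toAlgFun_X_ne_zero _), one_pow, one_mul]

theorem star_unstar {d : ℕ} {p : MvPolynomial (Fin (k + 1)) ℂ} (hp : p.totalDegree ≤ d) :
    star d (unstar d p) = p := by
  apply toAlgFun_injective
  rw [toAlgFun_star (totalDegree_unstar_le d p), starHom_unstar hp, ← mul_assoc, ← mul_pow,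
    mul_inv_cancel₀ (toAlgFun_X_ne_zero _), one_pow, one_mul]

theorem unstar_add {d e : ℕ} {p : MvPolynomial (Fin (k + 1)) ℂ} (hp : p.totalDegree ≤ d) :
    unstar (d + e) p = X 0 ^ e * unstar d p := by
  apply toAlgFun_injective
  rw [map_mul, map_pow, toAlgFun_unstar hp, toAlgFun_unstar (hp.trans (Nat.le_add_right _ _))]
  ring

theorem star_ne_zero {d : ℕ} {p : MvPolynomial (Fin (k + 1)) ℂ} (hp : p.totalDegree ≤ d)
    (h0 : p ≠ 0) : star d p ≠ 0 := by
  intro h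
  apply h0
  rw [← unstar_star hp, h]
  simp [unstar, homSubst]

theorem star_one_X_zero : star 1 (X 0 : MvPolynomial (Fin (k + 1)) ℂ) = 1 := by
  apply toAlgFun_injective
  rw [toAlgFun_star (totalDegree_X _).le, starHom, aeval_X, starVars_zero, pow_one,
    mul_div_cancel₀ _ (toAlgFun_X_ne_zero _)]

theorem dvd_of_star_dvd {p q : MvPolynomial (Fin (k + 1)) ℂ} (hp : Prime p)
    (hX : ¬ p ∣ X 0) (h : ∃ e, p ∣ X 0 ^ e * q) : p ∣ q := by
  obtain ⟨e, he⟩ := h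
  exact (hp.dvd_or_dvd he).resolve_left fun h => hX (hp.dvd_of_dvd_pow h)

/-- The hyperplane `x₁ = 0` is the one not visible in the chart `x₁ = 1`; this is why units are
admitted among the local semi-invariants. -/
theorem isUnit_star_of_dvd_X {p : MvPolynomial (Fin (k + 1)) ℂ} (hp : Prime p)
    (hX : p ∣ X 0) : IsUnit (star p.totalDegree p) := by
  obtain ⟨c, hc⟩ := hX
  have hc0 : c ≠ 0 := by
    rintro rfl
    simp at hc
  have hdeg := totalDegree_mul_of_isDomain hp.ne_zero hc0
  rw [← hc, totalDegree_X] at hdeg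
  have h := star_mul (le_refl p.totalDegree) (le_refl c.totalDegree)
  rw [← hc, ← hdeg, star_one_X_zero] at h
  exact IsUnit.of_mul_eq_one _ h.symm

theorem prime_star {p : MvPolynomial (Fin (k + 1)) ℂ} (hp : Prime p) (hX : ¬ p ∣ X 0)
    (hu : ¬ IsUnit (star p.totalDegree p)) : Prime (star p.totalDegree p) := by
  set r := p.totalDegree with hr
  have key : ∀ A : MvPolynomial (Fin (k + 1)) ℂ, p ∣ unstar A.totalDegree A → star r p ∣ A := by
    rintro A ⟨C, hC⟩
    rcases eq_or_ne A 0 with rfl | hA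
    · exact dvd_zero _
    have hC0 : C ≠ 0 := by
      rintro rfl
      apply hA
      rw [← star_unstar (le_refl A.totalDegree), hC]
      simp [star, homSubst]
    have hdeg := totalDegree_mul_of_isDomain hp.ne_zero hC0
    have hle := totalDegree_unstar_le A.totalDegree A
    rw [hC, hdeg] at hle
    have h := star_mul (le_refl p.totalDegree) (show C.totalDegree ≤ A.totalDegree - r by omega)
    rw [← hC, show p.totalDegree + (A.totalDegree - r) = A.totalDegree by omega,
      star_unstar le_rfl] at h
    exact ⟨_, h⟩
  refine ⟨star_ne_zero le_rfl hp.ne_zero, hu, ?_⟩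
  rintro A B ⟨C, hC⟩
  -- Both sides are transformed back with a common degree bound; the slack only produces powers of
  -- `x₁`, which can be cancelled as `p` does not divide `x₁`.
  have h1 : unstar (A.totalDegree + B.totalDegree + (r + C.totalDegree)) (A * B) =
      unstar (r + C.totalDegree + (A.totalDegree + B.totalDegree)) (star r p * C) := by
    rw [hC, add_comm (A.totalDegree + B.totalDegree)]
  rw [unstar_add (totalDegree_mul _ _), unstar_add ((totalDegree_mul _ _).trans
    (add_le_add (totalDegree_star_le _ _) le_rfl)), unstar_mul le_rfl le_rfl,
    unstar_mul (totalDegree_star_le _ _) le_rfl, unstar_star le_rfl] at h1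
  have h2 : p ∣ unstar A.totalDegree A * unstar B.totalDegree B := by
    refine dvd_of_star_dvd hp hX ⟨r + C.totalDegree, ?_⟩
    rw [h1]
    exact Dvd.dvd.mul_left (dvd_mul_right _ _) _
  exact (hp.dvd_or_dvd h2).imp (key A) (key B)

theorem isUnit_or_prime_star {p : MvPolynomial (Fin (k + 1)) ℂ} (hp : Prime p) :
    IsUnit (star p.totalDegree p) ∨ Prime (star p.totalDegree p) := by
  by_cases hX : p ∣ X 0
  · exact Or.inl (isUnit_star_of_dvd_X hp hX)
  · exact or_iff_not_imp_left.2 (prime_star hp hX)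

theorem isRelPrime_of_isUnit_or_prime {M : Type*} [CommMonoidWithZero M] [IsCancelMulZero M]
    {a b : M} (ha : IsUnit a ∨ Prime a) (h : IsUnit a ∨ ¬ a ∣ b) : IsRelPrime a b := by
  rcases ha with ha | ha
  · exact ha.isRelPrime_left
  rcases h with h | h
  · exact h.isRelPrime_left
  · exact (ha.irreducible.isRelPrime_iff_not_dvd).2 h

theorem isRelPrime_star {p q : MvPolynomial (Fin (k + 1)) ℂ} (hp : Prime p)
    (hpq : IsRelPrime p q) : IsRelPrime (star p.totalDegree p) (star q.totalDegree q) := by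
  refine isRelPrime_of_isUnit_or_prime (isUnit_or_prime_star hp) ?_
  by_cases hX : p ∣ X 0
  · exact Or.inl (isUnit_star_of_dvd_X hp hX)
  right
  rintro ⟨C, hC⟩
  apply hp.not_isUnit
  refine hpq dvd_rfl (dvd_of_star_dvd hp hX ⟨p.totalDegree + C.totalDegree, ?_⟩)
  have h1 : unstar (q.totalDegree + (p.totalDegree + C.totalDegree)) (star q.totalDegree q) =
      unstar (p.totalDegree + C.totalDegree + q.totalDegree) (star p.totalDegree p * C) := by
    rw [hC, add_comm q.totalDegree]
  rw [unstar_add (totalDegree_star_le _ _), unstar_add ((totalDegree_mul _ _).trans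
    (add_le_add (totalDegree_star_le _ _) le_rfl)), unstar_star le_rfl,
    unstar_mul (totalDegree_star_le _ _) le_rfl, unstar_star le_rfl] at h1
  rw [h1]
  exact Dvd.dvd.mul_left (dvd_mul_right _ _) _

/-- Since `star` uses the exact degree of `p`, a factor `X (Fin.last k)` would, on transforming
back, exhibit `p` as a polynomial of smaller degree. -/
theorem isRelPrime_X_last_star {p : MvPolynomial (Fin (k + 1)) ℂ} (hp : p ≠ 0) :
    IsRelPrime (X (Fin.last k)) (star p.totalDegree p) := by
  refine isRelPrime_of_isUnit_or_prime (Or.inr X_prime) (Or.inr ?_)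
  rintro ⟨C, hC⟩
  have hC0 : C ≠ 0 := by
    rintro rfl
    rw [mul_zero] at hC
    exact star_ne_zero le_rfl hp hC
  have hdeg := totalDegree_mul_of_isDomain (X_ne_zero (R := ℂ) (Fin.last k)) hC0
  rw [← hC, totalDegree_X] at hdeg
  have hle := totalDegree_star_le p.totalDegree p
  have h0 := toAlgFun_X_ne_zero (0 : Fin (k + 1))
  have h1 := congrArg (unstarHom k) hC
  rw [unstarHom_star le_rfl, map_mul] at h1
  have h2 : unstarHom k (X (Fin.last k)) = (toAlgFun (k + 1) (X 0))⁻¹ := by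
    simp [unstarHom, unstarVars_last]
  have h3 : unstar (p.totalDegree - 1) C = p := by
    apply toAlgFun_injective
    rw [toAlgFun_unstar (by omega)]
    obtain ⟨e, he⟩ : ∃ e, p.totalDegree = e + 1 := ⟨p.totalDegree - 1, by omega⟩
    rw [h2, he, pow_succ] at h1
    rw [he, Nat.add_sub_cancel]
    have h5 : unstarHom k C = (toAlgFun (k + 1) (X 0))⁻¹ ^ e * toAlgFun (k + 1) p :=
      mul_left_cancel₀ (inv_ne_zero h0) (by rw [← h1]; ring)
    rw [h5, ← mul_assoc, ← mul_pow, mul_inv_cancel₀ h0, one_pow, one_mul]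
  have h4 := totalDegree_unstar_le (p.totalDegree - 1) C
  rw [h3] at h4
  omega

theorem eval_zero_star {p : MvPolynomial (Fin (k + 1)) ℂ} (d : ℕ) :
    eval 0 (star d p) = eval (e1 (k + 1)) (homogeneousComponent d p) := by
  have h : ∀ q : MvPolynomial (Fin (k + 1)) ℂ,
      eval 0 (aeval (starVars k) q) = eval (e1 (k + 1)) q := by
    intro q
    induction q using MvPolynomial.induction_on with
    | C c => simp
    | add p q hp hq => simp only [map_add, hp, hq]
    | mul_X p i hp =>
      rw [map_mul, map_mul, map_mul, hp, aeval_X, eval_X]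
      congr 1
      refine Fin.cases ?_ (fun i => ?_) i
      · simp [starVars_zero, e1]
      · simp [starVars_succ, e1]
  rw [star, homSubst, map_sum, Finset.sum_range_succ, Finset.sum_eq_zero]
  · rw [zero_add, Nat.sub_self, pow_zero, mul_one, h]
  · intro j hj
    rw [Finset.mem_range] at hj
    rw [map_mul, map_pow, eval_X, Pi.zero_apply, zero_pow (by omega), mul_zero]

end Star

end PolyVF

end

noncomputable section

namespace PolyVF

/-! ### Semi-invariants and divergence of the Poincaré transform -/

section Transform

variable {k m : ℕ} {f : VField (k + 1)}

theorem aeval_homogenization_castSucc (m : ℕ) (f : VField (k + 1)) (j : Fin (k + 1)) :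
    aeval (Fin.cons (α := fun _ => MvPolynomial (Fin (k + 1)) ℂ) 1 X)
      (homogenization m f j.castSucc) = star m (f j) := by
  have hv : (Fin.cons (α := fun _ => MvPolynomial (Fin (k + 1)) ℂ) 1 X :
      Fin (k + 2) → MvPolynomial (Fin (k + 1)) ℂ) ∘ Fin.castSucc = starVars k := by
    funext i
    refine Fin.cases rfl (fun i => ?_) i
    rw [Function.comp_apply, ← Fin.succ_castSucc, Fin.cons_succ, starVars_succ]
  rw [homogenization, Fin.snoc_castSucc, map_sum, star, homSubst]
  refine Finset.sum_congr rfl fun i _ => ?_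
  rw [map_mul, map_pow, aeval_rename, hv, aeval_X, ← Fin.succ_last, Fin.cons_succ]

theorem poincareE1_castSucc (m : ℕ) (f : VField (k + 1)) (i : Fin k) :
    poincareE1 m f i.castSucc = -(star m (f 0)) * X i.castSucc + star m (f i.succ) := by
  rw [poincareE1, projection, map_add, map_mul, map_mul, map_neg, Fin.succ_castSucc,
    aeval_homogenization_castSucc, ← Fin.castSucc_zero, aeval_homogenization_castSucc,
    aeval_X, aeval_X, Fin.castSucc_zero, Fin.cons_zero, one_mul, ← Fin.succ_castSucc,
    Fin.cons_succ]

theorem poincareE1_last (m : ℕ) (f : VField (k + 1)) :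
    poincareE1 m f (Fin.last k) = -(star m (f 0)) * X (Fin.last k) := by
  have h : homogenization m f (Fin.last (k + 1)) = 0 := by simp [homogenization]
  rw [poincareE1, projection, map_add, map_mul, map_mul, map_neg, Fin.succ_last, h, map_zero,
    ← Fin.castSucc_zero, aeval_homogenization_castSucc, aeval_X, ← Fin.succ_last, Fin.cons_succ,
    mul_zero, add_zero]

theorem lieDeriv_X {n : ℕ} (F : VField n) (i : Fin n) : lieDeriv F (X i) = F i :=
  mkDerivation_X _ _ _

theorem lieDeriv_poincareE1_X_last (m : ℕ) (f : VField (k + 1)) :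
    lieDeriv (poincareE1 m f) (X (Fin.last k)) = -(star m (f 0)) * X (Fin.last k) := by
  rw [lieDeriv_X, poincareE1_last]

/-- A quotient rule for the functions defining `starHom`. -/
theorem derivation_div_field {K : Type*} [Field K] [Algebra ℂ K] (D : Derivation ℂ K K) (a b : K) :
    D (a / b) = (b * D a - a * D b) / b ^ 2 := by
  rw [Derivation.leibniz_div, smul_eq_mul, smul_eq_mul, smul_eq_mul, div_eq_inv_mul, inv_pow]

/-- The birational substitution carries `f` to its Poincaré transform up to the factor `x_{n+1} ^
m`, a rescaling of time. By the chain rule it suffices to check the coordinates. -/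
theorem lieDerivAlg_starHom (hf : ∀ i, (f i).totalDegree ≤ m + 1)
    (p : MvPolynomial (Fin (k + 1)) ℂ) :
    lieDerivAlg (poincareE1 (m + 1) f) (starHom k p) =
      toAlgFun (k + 1) (X (Fin.last k)) ^ m * starHom k (lieDeriv f p) := by
  have h0 := toAlgFun_X_ne_zero (Fin.last k)
  have hgen : ∀ i, lieDerivAlg (poincareE1 (m + 1) f)
      (toAlgFun (k + 1) (starVars k i) / toAlgFun (k + 1) (X (Fin.last k))) =
      toAlgFun (k + 1) (X (Fin.last k)) ^ m * starHom k (f i) := by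
    intro i
    rw [derivation_div_field, lieDerivAlg_toAlgFun, lieDerivAlg_toAlgFun,
      lieDeriv_poincareE1_X_last]
    refine Fin.cases ?_ (fun i => ?_) i
    · rw [starVars_zero, Derivation.map_one_eq_zero, map_zero, map_mul, map_neg,
        toAlgFun_star (hf 0), map_one]
      field_simp
      ring
    · rw [starVars_succ, lieDeriv_X, poincareE1_castSucc, map_add, map_mul, map_mul, map_neg,
        toAlgFun_star (hf 0), toAlgFun_star (hf i.succ)]
      field_simp
      ring
  rw [starHom, derivation_aeval, lieDeriv_apply, map_sum, Finset.mul_sum]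
  refine Finset.sum_congr rfl fun i _ => ?_
  rw [hgen, map_mul, starHom]
  ring

theorem derivation_pow_field {K : Type*} [Field K] [Algebra ℂ K] (D : Derivation ℂ K K) {a c : K}
    (h : D a = c * a) (r : ℕ) : D (a ^ r) = r * c * a ^ r := by
  induction r with
  | zero => simp
  | succ r ih =>
    rw [pow_succ, Derivation.leibniz, ih, h, smul_eq_mul, smul_eq_mul]
    push_cast
    ring

/-- The transform of a semi-invariant is a semi-invariant of the transform. -/
theorem lieDeriv_star (hf : ∀ i, (f i).totalDegree ≤ m + 1) {r : ℕ}
    {p l : MvPolynomial (Fin (k + 1)) ℂ} (hp : p.totalDegree ≤ r) (hl : l.totalDegree ≤ m)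
    (h : lieDeriv f p = l * p) :
    lieDeriv (poincareE1 (m + 1) f) (star r p) =
      (star m l - C (r : ℂ) * star (m + 1) (f 0)) * star r p := by
  apply toAlgFun_injective
  have hZ : lieDerivAlg (poincareE1 (m + 1) f) (toAlgFun (k + 1) (X (Fin.last k))) =
      -toAlgFun (k + 1) (star (m + 1) (f 0)) * toAlgFun (k + 1) (X (Fin.last k)) := by
    rw [lieDerivAlg_toAlgFun, lieDeriv_poincareE1_X_last, map_mul, map_neg]
  rw [← lieDerivAlg_toAlgFun, toAlgFun_star hp, Derivation.leibniz, lieDerivAlg_starHom hf, h,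
    derivation_pow_field _ hZ, map_mul (toAlgFun (k + 1)), toAlgFun_star hp, map_sub,
    toAlgFun_star hl, map_mul (starHom k)]
  simp only [smul_eq_mul, map_mul, map_natCast]
  ring

theorem lieDeriv_piSingle {n : ℕ} (i : Fin n) (p : MvPolynomial (Fin n) ℂ) :
    lieDeriv (Pi.single i 1) p = pderiv i p := by
  rw [lieDeriv, pderiv_def]

theorem pderiv_castSucc_star (i : Fin k) {p : MvPolynomial (Fin (k + 1)) ℂ}
    (hp : p.totalDegree ≤ m + 1) :
    toAlgFun (k + 1) (pderiv i.castSucc (star (m + 1) p)) =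
      toAlgFun (k + 1) (X (Fin.last k)) ^ m * starHom k (pderiv i.succ p) := by
  have h0 := toAlgFun_X_ne_zero (Fin.last k)
  have hZ : lieDerivAlg (Pi.single i.castSucc 1) (toAlgFun (k + 1) (X (Fin.last k))) = 0 := by
    rw [lieDerivAlg_toAlgFun, lieDeriv_piSingle, pderiv_X_of_ne (Fin.castSucc_lt_last i).ne',
      map_zero]
  have hgen : ∀ j, lieDerivAlg (Pi.single i.castSucc 1)
      (toAlgFun (k + 1) (starVars k j) / toAlgFun (k + 1) (X (Fin.last k))) =
      if j = i.succ then (toAlgFun (k + 1) (X (Fin.last k)))⁻¹ else 0 := by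
    intro j
    rw [derivation_div_field, hZ, lieDerivAlg_toAlgFun, lieDeriv_piSingle]
    refine Fin.cases ?_ (fun j => ?_) j
    · rw [starVars_zero, pderiv_one, if_neg (Fin.succ_ne_zero i).symm]
      simp
    · rw [starVars_succ, pderiv_X]
      rcases eq_or_ne j i with rfl | hij
      · simp
        field_simp
      · have : j.castSucc ≠ i.castSucc := fun h => hij (Fin.castSucc_injective _ h)
        simp [this, hij]
  rw [← lieDeriv_piSingle, ← lieDerivAlg_toAlgFun, toAlgFun_star hp, Derivation.leibniz,
    Derivation.leibniz_pow, hZ, starHom, derivation_aeval]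
  simp only [hgen, smul_zero, add_zero, smul_eq_mul, mul_ite, mul_zero, Finset.sum_ite_eq',
    Finset.mem_univ, if_true]
  field_simp
  ring

/-- Euler's identity for the homogenization, solved for the derivative in the homogenizing variable.
-/
theorem X_last_mul_pderiv_last_star {p : MvPolynomial (Fin (k + 1)) ℂ}
    (hp : p.totalDegree ≤ m + 1) :
    toAlgFun (k + 1) (X (Fin.last k) * pderiv (Fin.last k) (star (m + 1) p)) =
      (m + 1) * toAlgFun (k + 1) (star (m + 1) p) - toAlgFun (k + 1) (X (Fin.last k)) ^ m *
        ∑ j, starHom k (pderiv j p) * toAlgFun (k + 1) (starVars k j) := by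
  have h0 := toAlgFun_X_ne_zero (Fin.last k)
  have hZ : lieDerivAlg (Pi.single (Fin.last k) 1) (toAlgFun (k + 1) (X (Fin.last k))) = 1 := by
    rw [lieDerivAlg_toAlgFun, lieDeriv_piSingle, pderiv_X_self, map_one]
  have hgen : ∀ j, lieDerivAlg (Pi.single (Fin.last k) 1)
      (toAlgFun (k + 1) (starVars k j) / toAlgFun (k + 1) (X (Fin.last k))) =
      toAlgFun (k + 1) (starVars k j) * -((toAlgFun (k + 1) (X (Fin.last k)))⁻¹ ^ 2) := by
    intro j
    have hj : pderiv (Fin.last k) (starVars k j) = 0 := by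
      refine Fin.cases ?_ (fun j => ?_) j
      · rw [starVars_zero, pderiv_one]
      · rw [starVars_succ, pderiv_X_of_ne (Fin.castSucc_lt_last j).ne]
    rw [derivation_div_field, hZ, lieDerivAlg_toAlgFun, lieDeriv_piSingle, hj, map_zero]
    field_simp
    ring
  rw [map_mul, ← lieDeriv_piSingle, ← lieDerivAlg_toAlgFun, toAlgFun_star hp, Derivation.leibniz,
    Derivation.leibniz_pow, hZ, starHom, derivation_aeval]
  simp only [hgen, ← mul_assoc, ← Finset.sum_mul, smul_eq_mul, nsmul_eq_mul, Nat.add_sub_cancel]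
  push_cast
  field_simp
  ring

theorem totalDegree_divergence_le {n : ℕ} {f : VField n} (hf : ∀ i, (f i).totalDegree ≤ m + 1) :
    (divergence f).totalDegree ≤ m := by
  refine totalDegree_finsetSum_le fun i _ => ?_
  rcases eq_or_ne (pderiv i (f i)) 0 with h | h
  · simp [h]
  · have := totalDegree_pderiv_lt h
    have := hf i
    omega

/-- The cofactor of a semi-invariant of a vector field of degree `m + 1` has degree at most `m`. -/
theorem totalDegree_cofactor_le {n : ℕ} {f : VField n} (hf : ∀ i, (f i).totalDegree ≤ m + 1)
    {p l : MvPolynomial (Fin n) ℂ} (hp : p ≠ 0) (h : lieDeriv f p = l * p) :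
    l.totalDegree ≤ m := by
  rcases eq_or_ne l 0 with rfl | hl
  · simp
  have h1 := totalDegree_mul_of_isDomain hl hp
  have h2 : (lieDeriv f p).totalDegree ≤ m + p.totalDegree := by
    rw [lieDeriv_apply]
    refine totalDegree_finsetSum_le fun i _ => ?_
    rcases eq_or_ne (pderiv i p) 0 with h0 | h0
    · simp [h0]
    · have h3 := totalDegree_mul (f i) (pderiv i p)
      have h4 := totalDegree_pderiv_lt h0
      have h5 := hf i
      omega
  rw [h, h1] at h2
  omega

/-- The divergence of the Poincaré transform. -/
theorem divergence_poincareE1 (hf : ∀ i, (f i).totalDegree ≤ m + 1) :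
    divergence (poincareE1 (m + 1) f) =
      star m (divergence f) - C ((k + 1 + (m + 1) : ℕ) : ℂ) * star (m + 1) (f 0) := by
  apply toAlgFun_injective
  have h1 : ∀ i : Fin k, toAlgFun (k + 1) (pderiv i.castSucc (poincareE1 (m + 1) f i.castSucc)) =
      -toAlgFun (k + 1) (star (m + 1) (f 0)) -
        toAlgFun (k + 1) (X (Fin.last k)) ^ m *
          (starHom k (pderiv i.succ (f 0)) * toAlgFun (k + 1) (starVars k i.succ)) +
        toAlgFun (k + 1) (X (Fin.last k)) ^ m * starHom k (pderiv i.succ (f i.succ)) := by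
    intro i
    rw [poincareE1_castSucc, map_add, pderiv_mul, pderiv_X_self, map_neg, map_add, map_add,
      map_mul, map_mul, map_neg, map_neg, map_one, pderiv_castSucc_star i (hf _),
      pderiv_castSucc_star i (hf _), starVars_succ]
    ring
  have h2 : toAlgFun (k + 1) (pderiv (Fin.last k) (poincareE1 (m + 1) f (Fin.last k))) =
      -toAlgFun (k + 1) (star (m + 1) (f 0)) -
        toAlgFun (k + 1) (X (Fin.last k) * pderiv (Fin.last k) (star (m + 1) (f 0))) := by
    rw [poincareE1_last, pderiv_mul, pderiv_X_self, Derivation.map_neg]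
    simp only [map_add, map_mul, map_neg, map_one]
    ring
  -- In the total sum the derivatives of `f 0` in the variables `i.succ` cancel, and the remaining
  -- one completes the divergence of `f`. Euler's identity contributes the summand `m + 1` of the
  -- coefficient.
  rw [X_last_mul_pderiv_last_star (hf 0), Fin.sum_univ_succ, starVars_zero, map_one, mul_one] at h2
  rw [divergence, map_sum, Fin.sum_univ_castSucc, h2, Finset.sum_congr rfl fun i _ => h1 i,
    Finset.sum_add_distrib, Finset.sum_sub_distrib, map_sub,
    toAlgFun_star (totalDegree_divergence_le hf), divergence, map_sum, Fin.sum_univ_succ,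
    ← Finset.mul_sum, ← Finset.mul_sum]
  simp only [Finset.sum_const, Finset.card_univ, Fintype.card_fin, map_mul, map_natCast,
    nsmul_eq_mul]
  push_cast
  ring

end Transform

end PolyVF

end

noncomputable section

namespace PolyVF

/-! ### Highest degree parts -/

section TopPart

variable {n : ℕ}

theorem homogeneousComponent_mul_of_le {σ : Type*} {p q : MvPolynomial σ ℂ} {a b : ℕ}
    (hp : p.totalDegree ≤ a) (hq : q.totalDegree ≤ b) :
    homogeneousComponent (a + b) (p * q) = homogeneousComponent a p * homogeneousComponent b q := by
  classical
  have hz : ∀ {p : MvPolynomial σ ℂ} {a : ℕ}, p.totalDegree ≤ a → ∀ x : σ →₀ ℕ, a < x.degree →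
      coeff x p = 0 := by
    intro p a hp x hx
    refine coeff_eq_zero_of_totalDegree_lt (lt_of_le_of_lt hp ?_)
    exact hx
  ext c
  rw [coeff_homogeneousComponent]
  split_ifs with hc
  · rw [coeff_mul, coeff_mul]
    refine Finset.sum_congr rfl fun x hx => ?_
    rw [Finset.HasAntidiagonal.mem_antidiagonal] at hx
    rw [← hx, map_add] at hc
    rw [coeff_homogeneousComponent, coeff_homogeneousComponent]
    rcases lt_trichotomy x.1.degree a with h | h | h
    · rw [hz hq x.2 (by omega), mul_zero, if_neg h.ne, zero_mul]
    · rw [if_pos h, if_pos (by omega)]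
    · rw [hz hp x.1 h, zero_mul, if_neg h.ne', zero_mul]
  · exact (((homogeneousComponent_isHomogeneous a p).mul
      (homogeneousComponent_isHomogeneous b q)).coeff_eq_zero hc).symm

theorem homogeneousComponent_pderiv (j : ℕ) (i : Fin n) (p : MvPolynomial (Fin n) ℂ) :
    homogeneousComponent j (pderiv i p) = pderiv i (homogeneousComponent (j + 1) p) := by
  ext c
  rw [coeff_homogeneousComponent, coeff_pderiv, coeff_pderiv, coeff_homogeneousComponent, map_add,
    Finsupp.degree_single]
  by_cases h : c.degree = j
  · rw [if_pos h, if_pos (by omega)]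
  · rw [if_neg h, if_neg (by omega), zero_mul]

theorem homogeneousComponent_totalDegree_ne_zero {σ : Type*} {p : MvPolynomial σ ℂ} (hp : p ≠ 0) :
    homogeneousComponent p.totalDegree p ≠ 0 := by
  obtain ⟨b, hb, hbd⟩ := Finset.exists_mem_eq_sup p.support
    (Finset.nonempty_iff_ne_empty.2 (by simpa using hp)) (fun b => b.sum fun _ e => e)
  intro h
  have h1 := congrArg (coeff b) h
  rw [coeff_homogeneousComponent, if_pos (show b.degree = p.totalDegree from hbd.symm),
    coeff_zero] at h1
  exact mem_support_iff.1 hb h1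

/-- The highest degree part of a semi-invariant is a semi-invariant of the highest degree part. -/
theorem lieDeriv_homPart {m r : ℕ} {f : VField n} (hf : ∀ i, (f i).totalDegree ≤ m + 1)
    {p l : MvPolynomial (Fin n) ℂ} (hp : p.totalDegree ≤ r + 1) (hl : l.totalDegree ≤ m)
    (h : lieDeriv f p = l * p) :
    lieDeriv (homPart (m + 1) f) (homogeneousComponent (r + 1) p) =
      homogeneousComponent m l * homogeneousComponent (r + 1) p := by
  rw [← homogeneousComponent_mul_of_le hl hp, ← h, lieDeriv_apply, lieDeriv_apply, map_sum,
    show m + (r + 1) = m + 1 + r by ring]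
  refine Finset.sum_congr rfl fun i _ => ?_
  have h1 : (pderiv i p).totalDegree ≤ r := by
    rcases eq_or_ne (pderiv i p) 0 with h0 | h0
    · simp [h0]
    · have := totalDegree_pderiv_lt h0
      omega
  rw [homogeneousComponent_mul_of_le (hf i) h1, homogeneousComponent_pderiv, homPart]

theorem homogeneousComponent_subst (A : Matrix (Fin n) (Fin n) ℂ) (j : ℕ)
    (p : MvPolynomial (Fin n) ℂ) :
    homogeneousComponent j (subst A p) = subst A (homogeneousComponent j p) := by
  have h : ∀ i, (subst A (homogeneousComponent i p)).IsHomogeneous i := by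
    intro i
    have := (homogeneousComponent_isHomogeneous i p).aeval (fun k => ∑ l, C (A k l) * X l) (n := 1)
      (fun k => IsHomogeneous.sum _ _ _ fun l _ => isHomogeneous_C_mul_X _ _)
    rwa [one_mul] at this
  have hd : p.totalDegree ≤ p.totalDegree + j := Nat.le_add_right _ _
  conv_lhs => rw [← sum_homogeneousComponent_of_le hd, map_sum, map_sum]
  rw [Finset.sum_eq_single j, homogeneousComponent_of_mem (h j), if_pos rfl]
  · intro i _ hij
    rw [homogeneousComponent_of_mem (h i), if_neg (Ne.symm hij)]
  · intro hj
    rw [Finset.mem_range] at hj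
    omega

theorem homPart_conjugate (T : Matrix (Fin n) (Fin n) ℂ) (j : ℕ) (f : VField n) :
    homPart j (conjugate T f) = conjugate T (homPart j f) := by
  funext i
  simp only [homPart, conjugate_apply, map_sum, homogeneousComponent_C_mul,
    homogeneousComponent_subst]

theorem value_conjugate (T : Matrix (Fin n) (Fin n) ℂ) (f : VField n) (x : Fin n → ℂ) :
    value (conjugate T f) x = T.mulVec (value f (T⁻¹.mulVec x)) := by
  funext i
  simp [value, conjugate_apply, eval_subst, Matrix.mulVec, dotProduct]

end TopPart

/-! ### Invariant hypersurfaces -/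

section Invariance

variable {n : ℕ}

theorem hasDerivAt_eval {p : VField n} {x : ℝ → Fin n → ℂ} {t : ℝ}
    (hx : HasDerivAt x (value p (x t)) t) (q : MvPolynomial (Fin n) ℂ) :
    HasDerivAt (fun s => eval (x s) q) (eval (x t) (lieDeriv p q)) t := by
  induction q using MvPolynomial.induction_on with
  | C c => simpa using hasDerivAt_const t c
  | add q r hq hr =>
    simp only [map_add]
    exact hq.add hr
  | mul_X q i hq =>
    simp only [map_mul, eval_X]
    refine (hq.mul (hasDerivAt_pi.1 hx i)).congr_deriv ?_
    simp only [Derivation.leibniz, lieDeriv_X, smul_eq_mul, map_add, map_mul, eval_X, value]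
    ring

/-- The integrating factor `exp (-∫ μ)` makes the product constant. Along a solution, a
semi-invariant satisfies such an equation, so its zero set is invariant. -/
theorem eq_zero_of_linear_ode {a b : ℝ} {g μ : ℝ → ℂ} (hμ : ContinuousOn μ (Set.Ioo a b))
    (hg : ∀ t ∈ Set.Ioo a b, HasDerivAt g (μ t * g t) t) {t₀ : ℝ} (ht₀ : t₀ ∈ Set.Ioo a b)
    (h0 : g t₀ = 0) {t : ℝ} (ht : t ∈ Set.Ioo a b) : g t = 0 := by
  have hM : ∀ s ∈ Set.Ioo a b, HasDerivAt (fun s => ∫ u in t₀..s, μ u) (μ s) s := by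
    intro s hs
    refine intervalIntegral.integral_hasDerivAt_right ?_
      (hμ.stronglyMeasurableAtFilter isOpen_Ioo s hs) (hμ.continuousAt (Ioo_mem_nhds hs.1 hs.2))
    refine (hμ.mono ?_).intervalIntegrable
    exact Set.ordConnected_Ioo.uIcc_subset ht₀ hs
  have hE : ∀ s ∈ Set.Ioo a b,
      HasDerivAt (fun s => Complex.exp (-∫ u in t₀..s, μ u) * g s) 0 s := by
    intro s hs
    refine (((hM s hs).neg.cexp).mul (hg s hs)).congr_deriv ?_
    simp only [Pi.neg_apply]
    ring
  have := isOpen_Ioo.is_const_of_deriv_eq_zero isPreconnected_Ioo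
    (fun s hs => (hE s hs).differentiableAt.differentiableWithinAt) (fun s hs => (hE s hs).deriv)
    ht ht₀
  simpa [h0, Complex.exp_ne_zero] using this

theorem isFlowInvariant_zeroLocus {p : VField n} {q μ : MvPolynomial (Fin n) ℂ}
    (h : lieDeriv p q = μ * q) : IsFlowInvariant p {x | eval x q = 0} := by
  intro a b x hx t₀ ht₀ h0 t ht
  refine eq_zero_of_linear_ode (g := fun t => eval (x t) q) (μ := fun t => eval (x t) μ)
    (fun s hs => ?_) (fun s hs => ?_) ht₀ h0 ht
  · exact ((MvPolynomial.continuous_eval μ).continuousAt.comp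
      (hx s hs).continuousAt).continuousWithinAt
  · have := hasDerivAt_eval (hx s hs) q
    rwa [h, map_mul] at this

/-- If `0` were the only zero, the Nullstellensatz would make `q` divide powers of two different
variables; then `q` is a unit, contradicting `q(0) = 0`. -/
theorem exists_nonzero_root {q : MvPolynomial (Fin n) ℂ} (hn : 2 ≤ n) {r : ℕ}
    (hq : q.IsHomogeneous (r + 1)) : ∃ v : Fin n → ℂ, v ≠ 0 ∧ eval v q = 0 := by
  by_contra! hcon
  have hmem : ∀ i, ∃ e, q ∣ X i ^ e := by
    intro i
    have h1 : (X i : MvPolynomial (Fin n) ℂ) ∈ (Ideal.span {q}).radical := by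
      rw [← vanishingIdeal_zeroLocus_eq_radical (K := ℂ), mem_vanishingIdeal_iff]
      intro x hx
      have hx0 : x = 0 := by
        by_contra hne
        apply hcon x hne
        have := hx q (Ideal.subset_span rfl)
        simpa [aeval_eq_eval] using this
      simp [hx0]
    obtain ⟨e, he⟩ := h1
    exact ⟨e, Ideal.mem_span_singleton.1 he⟩
  obtain ⟨a, ha⟩ := hmem ⟨0, by omega⟩
  obtain ⟨b, hb⟩ := hmem ⟨1, by omega⟩
  obtain ⟨c, -, hc⟩ := (dvd_prime_pow X_prime a).1 ha
  rcases Nat.eq_zero_or_pos c with rfl | hc0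
  · rw [pow_zero, associated_one_iff_isUnit] at hc
    have h2 := hc.map (eval (0 : Fin n → ℂ))
    rw [eval_zero, constantCoeff_eq, hq.coeff_eq_zero (by simp)] at h2
    exact not_isUnit_zero h2
  · have h3 := (dvd_pow_self (X _) hc0.ne').trans (hc.symm.dvd.trans hb)
    have h4 := X_prime.dvd_of_dvd_pow h3
    rw [X_dvd_X] at h4
    simp at h4

theorem eval_smul_of_isHomogeneous {q : MvPolynomial (Fin n) ℂ} {r : ℕ} (hq : q.IsHomogeneous r)
    (c : ℂ) (v : Fin n → ℂ) : eval (c • v) q = c ^ r * eval v q := by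
  have := hq.aeval_mul c v
  rwa [aeval_eq_eval, aeval_eq_eval] at this

/-- Restriction to the line maps the coordinate ring of `Y` onto `ℂ[t]`, which has dimension one. -/
theorem one_le_varietyDim_of_line {Y : Set (Fin n → ℂ)} {v : Fin n → ℂ} (hv : v ≠ 0)
    (hY : ∀ c : ℂ, c • v ∈ Y) : 1 ≤ varietyDim Y := by
  obtain ⟨i, hi⟩ := Function.ne_iff.1 hv
  let H : MvPolynomial (Fin n) ℂ →ₐ[ℂ] Polynomial ℂ :=
    aeval fun i => Polynomial.C (v i) * Polynomial.X
  have hH : ∀ p c, (H p).eval c = eval (c • v) p := by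
    intro p c
    induction p using MvPolynomial.induction_on with
    | C a => simp [H]
    | add p q hp hq => simp only [map_add, Polynomial.eval_add, hp, hq]
    | mul_X p j hp =>
      rw [map_mul, map_mul, Polynomial.eval_mul, hp, aeval_X, Polynomial.eval_mul,
        Polynomial.eval_C, Polynomial.eval_X, eval_X, Pi.smul_apply, smul_eq_mul, mul_comm c]
  have hker : ∀ p ∈ vanishingIdeal ℂ Y, H.toRingHom p = 0 := by
    intro p hp
    refine Polynomial.funext fun c => ?_
    have := hp (c • v) (hY c)
    rw [aeval_eq_eval] at this
    rw [Polynomial.eval_zero, ← this]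
    exact hH p c
  have hsurj : Function.Surjective (Ideal.Quotient.lift _ H.toRingHom hker) := by
    apply Ideal.Quotient.lift_surjective_of_surjective
    intro P
    refine ⟨Polynomial.aeval (C (v i)⁻¹ * X i) P, ?_⟩
    change H _ = P
    rw [← Polynomial.aeval_algHom_apply]
    have : H (C (v i)⁻¹ * X i) = Polynomial.X := by
      have hi' : v i ≠ 0 := hi
      simp only [H, map_mul, algHom_C, aeval_X, Polynomial.algebraMap_eq, ← mul_assoc]
      rw [← Polynomial.C_mul, inv_mul_cancel₀ hi', Polynomial.C_1, one_mul]
    rw [this, Polynomial.aeval_X_left_apply]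
  have h1 := ringKrullDim_le_of_surjective _ hsurj
  rwa [IsPrincipalIdealRing.ringKrullDim_eq_one _ (Polynomial.not_isField ℂ)] at h1

/-- Under property S the highest degree part of a semi-invariant vanishes at a stationary point at
infinity. -/
theorem PropertyS.exists_stationary {m r : ℕ} {f : VField n} (hS : PropertyS m f) (hn : 2 ≤ n)
    {q μ : MvPolynomial (Fin n) ℂ} (hq : q.IsHomogeneous (r + 1)) (hq0 : q ≠ 0)
    (h : lieDeriv (homPart m f) q = μ * q) :
    ∃ v : Fin n → ℂ, v ≠ 0 ∧ (∃ c : ℂ, value (homPart m f) v = c • v) ∧ eval v q = 0 := by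
  obtain ⟨w, hw, hwq⟩ := exists_nonzero_root hn hq
  obtain ⟨v, hv, hc, hY⟩ := hS {x | eval x q = 0}
    ⟨{q}, by
      rintro p rfl
      exact ⟨r + 1, hq⟩, by simp⟩
    (fun hu => hq0 (MvPolynomial.funext fun x => by
      have : x ∈ {x | eval x q = 0} := hu ▸ Set.mem_univ x
      simpa using this))
    (isFlowInvariant_zeroLocus h)
    (one_le_varietyDim_of_line hw fun c => by
      rw [Set.mem_ofPred_eq, eval_smul_of_isHomogeneous hq, hwq, mul_zero])
  exact ⟨v, hv, hc, by simpa using hY 1⟩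

end Invariance

end PolyVF

end

noncomputable section

namespace PolyVF

/-! ### Jacobi multipliers -/

section JacobiMultiplier

variable {n : ℕ}

/-- Differentiate `ρ ^ d.den = p ^ d.num`: the logarithmic derivative does not depend on the branch.
-/
theorem lieDerivAlg_ratPow {f : VField n} {p l : MvPolynomial (Fin n) ℂ} (hp : p ≠ 0)
    (h : lieDeriv f p = l * p) {d : ℚ} {ρ : AlgFun n} (hρ : IsRatPow p d ρ) :
    ρ ≠ 0 ∧ lieDerivAlg f ρ = (d : AlgFun n) * toAlgFun n l * ρ := by
  have hp' : toAlgFun n p ≠ 0 := (map_ne_zero_iff _ (toAlgFun_injective n)).2 hp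
  have hρ' : ρ ^ d.den = toAlgFun n p ^ d.num := hρ
  have hρ0 : ρ ≠ 0 := by
    rintro rfl
    rw [zero_pow d.den_nz] at hρ'
    exact zpow_ne_zero _ hp' hρ'.symm
  refine ⟨hρ0, ?_⟩
  have h1 := congrArg (lieDerivAlg f) hρ'
  rw [Derivation.leibniz_pow, Derivation.leibniz_zpow, lieDerivAlg_toAlgFun, h, map_mul] at h1
  simp only [nsmul_eq_mul, zsmul_eq_mul, smul_eq_mul] at h1
  have h2 : toAlgFun n p ^ (d.num - 1) * (toAlgFun n l * toAlgFun n p) =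
      toAlgFun n l * ρ ^ d.den := by
    rw [hρ', zpow_sub_one₀ hp']
    field_simp
  obtain ⟨e, he⟩ : ∃ e, d.den = e + 1 := ⟨d.den - 1, by have := d.den_pos; omega⟩
  have hd : (d : AlgFun n) = d.num / d.den := by
    exact_mod_cast congrArg (Rat.cast (K := AlgFun n)) (Rat.num_div_den d).symm
  have hden : ((d.den : ℕ) : AlgFun n) ≠ 0 := Nat.cast_ne_zero.2 d.den_nz
  rw [h2] at h1
  rw [hd]
  apply mul_left_cancel₀ (pow_ne_zero e hρ0)
  apply mul_left_cancel₀ hden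
  rw [show d.den - 1 = e by omega] at h1
  rw [h1]
  field_simp
  rw [he, pow_succ]
  ring

theorem lieDerivAlg_prod {ι : Type*} (s : Finset ι) (f : VField n) (ρ c : ι → AlgFun n)
    (h : ∀ i, lieDerivAlg f (ρ i) = c i * ρ i) :
    lieDerivAlg f (∏ i ∈ s, ρ i) = (∑ i ∈ s, c i) * ∏ i ∈ s, ρ i := by
  classical
  induction s using Finset.induction_on with
  | empty => simp
  | insert a s ha ih =>
    rw [Finset.prod_insert ha, Finset.sum_insert ha, Derivation.leibniz, ih, h, smul_eq_mul,
      smul_eq_mul]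
    ring

/-- The divergence is the weighted sum of the cofactors. -/
theorem sum_cofactor_eq_divergence {s : ℕ} {f : VField n} {φ l : Fin s → MvPolynomial (Fin n) ℂ}
    (h0 : ∀ i, φ i ≠ 0) (h : ∀ i, lieDeriv f (φ i) = l i * φ i) {d : Fin s → ℚ}
    {ρ : Fin s → AlgFun n} (hρ : ∀ i, IsRatPow (φ i) (d i) (ρ i))
    (hJ : IsJacobiMultiplier f (∏ i, ρ i)⁻¹) : ∑ i, C (d i : ℂ) * l i = divergence f := by
  apply toAlgFun_injective
  have hP := lieDerivAlg_prod Finset.univ f ρ _ fun i =>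
    (lieDerivAlg_ratPow (h0 i) (h i) (hρ i)).2
  have hP0 : ∏ i, ρ i ≠ 0 := Finset.prod_ne_zero_iff.2 fun i _ =>
    (lieDerivAlg_ratPow (h0 i) (h i) (hρ i)).1
  have h1 := hJ.2
  rw [Derivation.leibniz_inv, hP, smul_eq_mul] at h1
  have h2 : algebraMap _ (AlgFun n) (divergence f) = ∑ i, (d i : AlgFun n) * toAlgFun n (l i) := by
    field_simp at h1
    linear_combination h1
  refine Eq.trans ?_ h2.symm
  rw [map_sum]
  refine Finset.sum_congr rfl fun i _ => ?_
  rw [map_mul, ← algebraMap_eq, AlgHom.commutes, map_ratCast]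

end JacobiMultiplier

/-! ### Stationary points at infinity -/

section Stationary

variable {k m s : ℕ} {f : VField (k + 1)}

theorem exists_matrix_mulVec_eq {n : ℕ} {v w : Fin n → ℂ} (hv : v ≠ 0) (hw : w ≠ 0) :
    ∃ T : Matrix (Fin n) (Fin n) ℂ, IsUnit T.det ∧ T.mulVec v = w := by
  obtain ⟨A, hA⟩ := SeparatingDual.exists_continuousLinearEquiv_apply_eq (R := ℂ) hv hw
  refine ⟨LinearMap.toMatrix' (A.toLinearEquiv : (Fin n → ℂ) →ₗ[ℂ] (Fin n → ℂ)), ?_, ?_⟩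
  · rw [LinearMap.det_toMatrix']
    exact LinearEquiv.isUnit_det' _
  · rw [LinearMap.toMatrix'_mulVec]
    exact hA

theorem inv_mulVec_eq {n : ℕ} {T : Matrix (Fin n) (Fin n) ℂ} {v w : Fin n → ℂ}
    (hT : IsUnit T.det) (h : T.mulVec v = w) : T⁻¹.mulVec w = v := by
  rw [← h, Matrix.mulVec_mulVec, Matrix.nonsing_inv_mul _ hT, Matrix.one_mulVec]

theorem e1_ne_zero (k : ℕ) : e1 (k + 1) ≠ 0 := by
  intro h
  have := congrFun h 0
  simp [e1] at this

/-- The Poincaré transforms at an invariant line of the highest degree part vanish at `0`. -/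
theorem exists_transform_of_line {v : Fin (k + 1) → ℂ} (hv : v ≠ 0) {c : ℂ}
    (hc : value (homPart m f) v = c • v) :
    ∃ F, IsPoincareTransform m f v F ∧ value F 0 = 0 := by
  obtain ⟨T, hT, hTv⟩ := exists_matrix_mulVec_eq hv (e1_ne_zero k)
  refine ⟨_, ⟨hv, T, hT, hTv, rfl⟩, ?_⟩
  funext i
  refine Fin.lastCases ?_ (fun i => ?_) i
  · rw [value, poincareE1_last, map_mul, eval_X, Pi.zero_apply, mul_zero]
  · have h1 : value (homPart m (conjugate T f)) (e1 (k + 1)) = c • e1 (k + 1) := by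
      rw [homPart_conjugate, value_conjugate, inv_mulVec_eq hT hTv, hc, Matrix.mulVec_smul, hTv]
    have h2 := congrFun h1 i.succ
    rw [value, poincareE1_castSucc, map_add, map_mul, eval_X, Pi.zero_apply, mul_zero, zero_add,
      eval_zero_star]
    refine h2.trans ?_
    simp [e1]

theorem sum_C_mul_star {ι : Type*} [Fintype ι] (a : ι → ℂ) (p : ι → MvPolynomial (Fin (k + 1)) ℂ)
    (d : ℕ) (hp : ∀ i, (p i).totalDegree ≤ d) :
    ∑ i, C (a i) * star d (p i) = star d (∑ i, C (a i) * p i) := by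
  apply toAlgFun_injective
  rw [toAlgFun_star, map_sum, map_sum, Finset.mul_sum]
  · refine Finset.sum_congr rfl fun i _ => ?_
    rw [map_mul, map_mul, toAlgFun_star (hp i), ← algebraMap_eq, AlgHom.commutes, AlgHom.commutes]
    ring
  · refine totalDegree_finsetSum_le fun i _ => (totalDegree_mul _ _).trans ?_
    rw [totalDegree_C, zero_add]
    exact hp i

/-- The semi-invariants, together with the hyperplane at infinity, near a stationary point at
infinity. -/
theorem exists_local_semiinvariants (hf : ∀ i, (f i).totalDegree ≤ m + 1)
    {φ l : Fin s → MvPolynomial (Fin (k + 1)) ℂ} (hφ : ∀ i, Prime (φ i))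
    (hcop : ∀ i j, i ≠ j → IsRelPrime (φ i) (φ j))
    (h : ∀ i, lieDeriv f (φ i) = l i * φ i) {d : Fin s → ℚ}
    (hdiv : ∑ i, C (d i : ℂ) * l i = divergence f)
    {v : Fin (k + 1) → ℂ} {F : VField (k + 1)} (hF : IsPoincareTransform (m + 1) f v F) :
    ∃ ψ κ : Option (Fin s) → MvPolynomial (Fin (k + 1)) ℂ,
      (∀ i, lieDeriv F (ψ i) = κ i * ψ i) ∧ (∀ i, IsUnit (ψ i) ∨ Prime (ψ i)) ∧
      (∀ i i', i ≠ i' → IsRelPrime (ψ i) (ψ i')) ∧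
      ∑ i, C (((i.elim ((k + 1 + (m + 1) : ℕ) - ∑ i, d i * (φ i).totalDegree) d : ℚ)) : ℂ) * κ i =
        divergence F ∧
      eval 0 (ψ none) = 0 ∧
      ∀ i, eval 0 (ψ (some i)) = eval v (homogeneousComponent (φ i).totalDegree (φ i)) := by
  obtain ⟨-, T, hT, hTv, rfl⟩ := hF
  have hg := totalDegree_conjugate_le T hf
  have hφT : ∀ i, Prime (subst T⁻¹ (φ i)) := by
    intro i
    rw [← substEquiv_apply T hT, MulEquiv.prime_iff (substEquiv T hT)]
    exact hφ i
  have hdeg := totalDegree_subst_inv T hT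
  have hl : ∀ i, (subst T⁻¹ (l i)).totalDegree ≤ m := fun i => by
    rw [hdeg]
    exact totalDegree_cofactor_le hf (hφ i).ne_zero (h i)
  refine ⟨fun i => i.elim (X (Fin.last k)) fun i => star (φ i).totalDegree (subst T⁻¹ (φ i)),
    fun i => i.elim (-(star (m + 1) (conjugate T f 0))) fun i => star m (subst T⁻¹ (l i)) -
      C ((φ i).totalDegree : ℂ) * star (m + 1) (conjugate T f 0), ?_, ?_, ?_, ?_, ?_, ?_⟩
  · rintro (_ | i)
    · exact lieDeriv_poincareE1_X_last _ _
    · refine lieDeriv_star hg (hdeg _).le (hl i) ?_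
      rw [lieDeriv_conjugate T hT, h, map_mul]
  · rintro (_ | i)
    · exact Or.inr X_prime
    · have := isUnit_or_prime_star (hφT i)
      rwa [hdeg] at this
  · have h1 : ∀ i, IsRelPrime (X (Fin.last k))
        (star (φ i).totalDegree (subst T⁻¹ (φ i))) := fun i => by
      have := isRelPrime_X_last_star (hφT i).ne_zero
      rwa [hdeg] at this
    rintro (_ | i) (_ | j) hij
    · exact absurd rfl hij
    · exact h1 j
    · exact (h1 i).symm
    · have h2 : IsRelPrime (subst T⁻¹ (φ i)) (subst T⁻¹ (φ j)) := by
        intro p h1 h2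
        rw [← substEquiv_apply T hT, ← (substEquiv T hT).apply_symm_apply p, map_dvd_iff] at h1 h2
        have := (hcop i j (fun h => hij (congrArg some h)) h1 h2).map (substEquiv T hT)
        rwa [(substEquiv T hT).apply_symm_apply] at this
      have := isRelPrime_star (hφT i) h2
      rwa [hdeg, hdeg] at this
  -- The cofactor of `star (φ i)` contains `-(deg φ i) * star f₁`, and that of `x_{n+1}` is `-star
  -- f₁`, with `f₁` the first component of the conjugated field. The exponent at `none` is what
  -- makes these terms add up to the one in `div F`.
  · rw [Fintype.sum_option, divergence_poincareE1 hg, divergence_conjugate T hT, ← hdiv, map_sum]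
    have h1 : ∀ i, subst T⁻¹ (C (d i : ℂ) * l i) = C (d i : ℂ) * subst T⁻¹ (l i) := fun i => by
      rw [map_mul, ← algebraMap_eq, AlgHom.commutes]
    simp only [h1, ← sum_C_mul_star _ _ _ hl, Option.elim, mul_sub, Finset.sum_sub_distrib,
      ← mul_assoc, ← C_mul, ← Finset.sum_mul, ← map_sum]
    push_cast
    rw [C_sub, C_add, C_add]
    ring
  · simp
  · intro i
    change eval 0 (star _ _) = _
    rw [eval_zero_star, homogeneousComponent_subst, eval_subst, inv_mulVec_eq hT hTv]

/-- The eigenvalues at the stationary points at infinity of a constant vector field coincide. -/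
theorem degree_pos_of_eigCond1 (hk : 1 ≤ k) {v : Fin (k + 1) → ℂ} {F : VField (k + 1)}
    (hF : IsPoincareTransform m f v F) (hE : EigCond1 (jacobianAtZero F)) : m ≠ 0 := by
  rintro rfl
  obtain ⟨-, T, hT, -, rfl⟩ := hF
  obtain ⟨ev, hev, hli⟩ := hE
  have hstar : ∀ p : MvPolynomial (Fin (k + 1)) ℂ, star 0 p = C (coeff 0 p) := by
    intro p
    simp [star, homSubst, homogeneousComponent_zero]
  have hB : jacobianAtZero (poincareE1 0 (conjugate T f)) =
      -(coeff 0 (conjugate T f 0)) • (1 : Matrix (Fin (k + 1)) (Fin (k + 1)) ℂ) := by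
    ext i j
    rw [jacobianAtZero, Matrix.of_apply, Matrix.smul_apply, Matrix.one_apply]
    refine Fin.lastCases ?_ (fun i => ?_) i
    · rw [poincareE1_last, hstar]
      simp [Pi.single_apply]
      split_ifs <;> simp
    · rw [poincareE1_castSucc, hstar, hstar]
      simp [Pi.single_apply]
      split_ifs <;> simp
  obtain ⟨S, hS, hSB⟩ := exists_diagonalization hev hli.injective
  rw [hB, Matrix.mul_smul, Matrix.smul_mul, mul_one, Matrix.mul_nonsing_inv _ hS] at hSB
  have h1 : ∀ i, ev i = -(coeff 0 (conjugate T f 0)) := by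
    intro i
    have := congrFun (congrFun hSB i) i
    simpa using this.symm
  -- The Jacobian is scalar, so in dimension at least two an eigenvalue repeats, against linear
  -- independence.
  have h2 := hli.injective ((h1 0).trans (h1 (Fin.last k)).symm)
  have := congrArg Fin.val h2
  simp at this
  omega

end Stationary

end PolyVF

end

/-! ### Proof of the theorem -/

theorem mainTheorem3 (n m s : ℕ) (hn : 2 ≤ n)
    (f : PolyVF.VField n) (hf : PolyVF.HasDegree f m)
    (hE : PolyVF.PropertyE m f) (hS : PolyVF.PropertyS m f)
    (φ : Fin s → MvPolynomial (Fin n) ℂ)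
    (hirr : ∀ i, Irreducible (φ i))
    (hcop : ∀ i j, i ≠ j → IsRelPrime (φ i) (φ j))
    (hsemi : ∀ i, PolyVF.IsSemiInvariant f (φ i))
    (d : Fin s → ℚ) (hd : ∀ i, d i ≠ 0)
    (ρ : Fin s → PolyVF.AlgFun n) (hρ : ∀ i, PolyVF.IsRatPow (φ i) (d i) (ρ i))
    (hJ : PolyVF.IsJacobiMultiplier f (∏ i, ρ i)⁻¹)
    (hw : ∃ (w : Fin n → ℂ) (F : PolyVF.VField n), PolyVF.IsPoincareTransform m f w F ∧
      PolyVF.value F 0 = 0 ∧ PolyVF.EigCond1 (PolyVF.jacobianAtZero F)) :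
    (∀ i, d i = 1) ∧ ∑ i, (φ i).totalDegree = m + n - 1 := by
  obtain ⟨k, rfl⟩ : ∃ k, n = k + 1 := ⟨n - 1, by omega⟩
  obtain ⟨w, F, hF, hF0, hFE⟩ := hw
  obtain ⟨m, rfl⟩ : ∃ m', m = m' + 1 :=
    ⟨m - 1, by have := PolyVF.degree_pos_of_eigCond1 (by omega) hF hFE; omega⟩
  choose hnc l hl using hsemi
  have hprime : ∀ i, Prime (φ i) := fun i => (hirr i).prime
  have hdiv := PolyVF.sum_cofactor_eq_divergence (fun i => (hprime i).ne_zero) hl hρ hJ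
  have hloc := fun {v F} => PolyVF.exists_local_semiinvariants (v := v) (F := F) hf.1 hprime hcop
    hl hdiv
  -- The hyperplane at infinity passes through every stationary point at infinity, so the point with
  -- independent eigenvalues forces its exponent to be `1`.
  have hinf : (((k + 1 + (m + 1) : ℕ) - ∑ i, d i * (φ i).totalDegree : ℚ)) = 1 := by
    obtain ⟨ψ, κ, h1, h2, h3, h4, h5, -⟩ := hloc hF
    exact PolyVF.eq_one_of_eigCond1 hF0 hFE h1 h2 h3 _ h4 (i := none) h5
  have hone : ∀ i, d i = 1 := by
    intro i
    obtain ⟨r, hr⟩ : ∃ r, (φ i).totalDegree = r + 1 := by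
      refine ⟨(φ i).totalDegree - 1, ?_⟩
      have : (φ i).totalDegree ≠ 0 := fun h0 => hnc i _ (totalDegree_eq_zero_iff_eq_C.1 h0)
      omega
    -- A stationary point at infinity at which the transform of `φ i` vanishes; its value at the
    -- origin of the chart is that of the top degree part of `φ i` at `v`.
    obtain ⟨v, hv, ⟨c, hc⟩, hv0⟩ := hS.exists_stationary hn (r := r)
      (homogeneousComponent_isHomogeneous (r + 1) (φ i)) (by
        rw [← hr]
        exact PolyVF.homogeneousComponent_totalDegree_ne_zero (hprime i).ne_zero)
      (PolyVF.lieDeriv_homPart hf.1 hr.le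
        (PolyVF.totalDegree_cofactor_le hf.1 (hprime i).ne_zero (hl i)) (hl i))
    obtain ⟨G, hG, hG0⟩ := PolyVF.exists_transform_of_line hv hc
    obtain ⟨ψ, κ, h1, h2, h3, h4, h5, h6⟩ := hloc hG
    have h7 : eval 0 (ψ (some i)) = 0 := by rw [h6, hr, hv0]
    rcases hE v G hG hG0 with hGE | hGE
    · exact PolyVF.eq_one_of_eigCond1 hG0 hGE h1 h2 h3 _ h4 (i := some i) h7
    · exact PolyVF.eq_one_of_eigCond2 hG0 hGE h1 h2 h3 _ h4 (i₀ := none) h5 hinf (i := some i) h7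
  refine ⟨hone, ?_⟩
  simp only [hone, one_mul] at hinf
  have h8 : ((∑ i, (φ i).totalDegree : ℕ) : ℚ) + 1 = ((k + 1 + (m + 1) : ℕ) : ℚ) := by
    push_cast at hinf ⊢
    linarith
  have h9 : ∑ i, (φ i).totalDegree + 1 = k + 1 + (m + 1) := by exact_mod_cast h8
  omega
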